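/- Theorem (large deviations for the number of vertices in triangles). Fix $\lambda\in(0,\infty)$ and, for $n\ge\lambda$, let $G_n$ be the Erdős–Rényi random graph on $n$ vertices in which each pair of distinct vertices is an edge with probability $p_n=\lambda/n$, independently of the other pairs. Let $V_T(G_n)$ be the number of vertices of $G_n$ that are part of a triangle, and write $x!=\Gamma(x+1)$ for real $x\ge 0$. Then, as $n\to\infty$, $$\mathbb{P}(V_T(G_n)\ge q)=\frac{n(n-1)\cdots(n-q+1)}{(3!)^{q/3}\,(q/3)!}\;p_n^{\,q}\;\mathrm{e}^{o(n^{19/20})}$$ uniformly over all integers $q\ge 0$; that is, the equality holds, for all large $n$ and all $q$, with $\mathrm{e}^{r(n,q)}$ as last factor, where $\sup_{q}|r(n,q)|=o(n^{19/20})$. (For $q>n$ both sides are $0$.) In particular, for every $a\in(0,1)$, as $n\to\infty$, $$\log\mathbb{P}(V_T(G_n)\ge an)=-n(1-a)\log(1-a)-\tfrac13an\,\log\left(\tfrac13an\right)-an\left(\tfrac23+\tfrac13\log 6\right)+an\log\lambda+o(n^{19/20}).$$ -/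

import Mathlib

/-- `V_T(G)`: the number of vertices of `G` that are part of a triangle of `G`. -/
noncomputable def verticesInTriangles {V : Type*} (G : SimpleGraph V) : ℕ :=
  Set.ncard {v : V | ∃ u w : V, G.Adj v u ∧ G.Adj u w ∧ G.Adj w v}

/-- The edge probability `p_n = lam / n`, projected to `[0, 1]`. The projection only acts when
`lam / n` is not a probability, that is, for the finitely many `n < lam`. -/
noncomputable def edgeProb (lam : ℝ) (n : ℕ) : unitInterval :=
  Set.projIcc (0 : ℝ) 1 zero_le_one (lam / n)

/-- The law of the Erdős–Rényi random graph `G_n = G(n, lam / n)` on the vertex set `Fin n`: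
every pair of distinct vertices is an edge with probability `lam / n`, independently. -/
noncomputable def erdosRenyi (lam : ℝ) (n : ℕ) : MeasureTheory.Measure (SimpleGraph (Fin n)) :=
  SimpleGraph.binomialRandom (Fin n) (edgeProb lam n)

/-- The factorial `x! = Γ(x + 1)` of a real number `x ≥ 0`; for natural `x` it is the usual one. -/
noncomputable def realFactorial (x : ℝ) : ℝ :=
  Real.Gamma (x + 1)

/-! The cheapest way to put `q` vertices into triangles is to have `q / 3` vertex-disjoint
triangles. For `q` divisible by 3 the main term is the expected number of unordered families of this
kind. Every deviation from this picture costs at most a factor `exp (O(n^(2/3)))`, which is better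
than the required `19/20`.

Upper bound. In any graph, choose a maximal family of `k` disjoint triangles, then a maximal family
of `b` disjoint pairs that complete triangles with a vertex of these, then a maximal set of `a`
single vertices that complete triangles with two vertices already used. By maximality this covers
every vertex in a triangle (`exists_isConfig`). In the expected number of such configurations
(`real_isConfig_le`) each vertex pays one factor `p`, each pair or single vertex pays a further
bounded factor, and symmetry divides by `k! 6^k b! a!`. Missing triangles gain at most
`(6n)^((2b+a)/3)`, and dividing by `b! a!` leaves `exp (O(n^(2/3)))` (`term_le_mainTerm`).

Lower bound. Given `k` prescribed disjoint triangles, the expected number of other triangles is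
bounded, so with conditional probability at least 1/2 there are at most `M` of them
(`le_real_fewTriangles`). A graph with at most `k + M` triangles contains only `k!` times a
polynomial number of sequences of `k` triangles, so the first moment is sharp up to a polynomial
factor (`descFactorial_mul_pow_le`). If 3 does not divide `q`, the one or two remaining vertices are
attached to existing triangles by two edges each (`sq_mul_real_le`).

Gamma function estimates and Stirling's formula then turn the main term into the two stated forms.
-/

namespace RandomGraph

open MeasureTheory SimpleGraph Filter

/-! ### The binomial random graph: single edges and double counting. -/

section Probability

variable {V : Type*}

instance [Countable V] : MeasurableSingletonClass (SimpleGraph V) where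
  measurableSet_singleton G := by
    have : {G} = edgeSet ⁻¹' {G.edgeSet} := by
      ext H
      simp
    rw [this]
    exact measurableEmbedding_edgeSet.measurable (measurableSet_singleton _)

lemma edgeSet_sup_fromEdgeSet_singleton (G : SimpleGraph V) {e : Sym2 V} (he : ¬ e.IsDiag) :
    (G ⊔ fromEdgeSet {e}).edgeSet = insert e G.edgeSet := by
  ext f
  simp only [edgeSet_sup, edgeSet_fromEdgeSet, Set.mem_union, Set.mem_sdiff, Set.mem_singleton_iff,
    Set.mem_insert_iff, Sym2.mem_diagSet]
  constructor
  · rintro (h | h)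
    · exact Or.inr h
    · exact Or.inl h.1
  · rintro (rfl | h)
    · exact Or.inr ⟨rfl, he⟩
    · exact Or.inl h

variable [Fintype V]

lemma real_singleton (p : unitInterval) (G : SimpleGraph V) :
    (binomialRandom V p).real {G} =
      (p : ℝ) ^ G.edgeSet.ncard * (1 - p : ℝ) ^ ((Nat.card V).choose 2 - G.edgeSet.ncard) := by
  simp [measureReal_def, binomialRandom_singleton]

lemma ncard_edgeSet_le (G : SimpleGraph V) : G.edgeSet.ncard ≤ (Nat.card V).choose 2 := by
  classical
  rw [Nat.card_eq_fintype_card, ← coe_edgeFinset, Set.ncard_coe_finset]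
  exact card_edgeFinset_le_card_choose_two

/-- One factor `1 - p` is exchanged for a factor `p`. The cross-multiplied form also covers `p = 1`.
-/
lemma real_singleton_sup (p : unitInterval) (G : SimpleGraph V) {e : Sym2 V} (he : ¬ e.IsDiag)
    (heG : e ∉ G.edgeSet) :
    (1 - p : ℝ) * (binomialRandom V p).real {G ⊔ fromEdgeSet {e}} =
      p * (binomialRandom V p).real {G} := by
  have h1 : (G ⊔ fromEdgeSet {e}).edgeSet.ncard = G.edgeSet.ncard + 1 := by
    rw [edgeSet_sup_fromEdgeSet_singleton G he, Set.ncard_insert_of_notMem heG]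
  have h2 := ncard_edgeSet_le (G ⊔ fromEdgeSet {e})
  rw [h1] at h2
  rw [real_singleton, real_singleton, h1]
  have h3 : (Nat.card V).choose 2 - G.edgeSet.ncard =
    (Nat.card V).choose 2 - (G.edgeSet.ncard + 1) + 1 := by omega
  rw [h3]
  ring

open Classical in
lemma real_eq_sum (p : unitInterval) (A : Set (SimpleGraph V)) :
    (binomialRandom V p).real A = ∑ G, if G ∈ A then (binomialRandom V p).real {G} else 0 := by
  rw [← Finset.sum_filter, sum_measureReal_singleton]
  simp

open Classical in
lemma real_setOf_eq_sum_filter (p : unitInterval) (P : SimpleGraph V → Prop) :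
    (binomialRandom V p).real {G | P G} =
      ∑ G with P G, (binomialRandom V p).real {G} := by
  rw [sum_measureReal_singleton]
  simp

open Classical in
-- A sum of probabilities is an expected count. Both moment arguments bound this count graph by
-- graph.
lemma sum_real_eq_sum (p : unitInterval) {ι : Type*} (Φ : Finset ι)
    (A : ι → Set (SimpleGraph V)) :
    ∑ i ∈ Φ, (binomialRandom V p).real (A i) =
      ∑ G, (Φ.filter fun i => G ∈ A i).card * (binomialRandom V p).real {G} := by
  rw [Finset.sum_congr rfl fun i _ => real_eq_sum p (A i), Finset.sum_comm]
  refine Finset.sum_congr rfl fun G _ => ?_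
  rw [← Finset.sum_filter, Finset.sum_const, nsmul_eq_mul]

/-- Independence of one edge: by `hA` the event ignores `e`, so adding and deleting `e` match its
graphs without `e` to those with `e`, with weights in ratio `1 - p : p`. -/
lemma real_inter_edge (p : unitInterval) {e : Sym2 V} (he : ¬ e.IsDiag) (A : Set (SimpleGraph V))
    (hA : ∀ G, G ⊔ fromEdgeSet {e} ∈ A ↔ G ∈ A) :
    (binomialRandom V p).real {G | G ∈ A ∧ e ∈ G.edgeSet} = p * (binomialRandom V p).real A := by
  classical
  have key : (1 - p : ℝ) * (binomialRandom V p).real {G | G ∈ A ∧ e ∈ G.edgeSet} =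
      p * (binomialRandom V p).real {G | G ∈ A ∧ e ∉ G.edgeSet} := by
    rw [real_setOf_eq_sum_filter, real_setOf_eq_sum_filter, Finset.mul_sum, Finset.mul_sum]
    have hdel : ∀ G : SimpleGraph V, e ∈ G.edgeSet → G.deleteEdges {e} ⊔ fromEdgeSet {e} = G := by
      intro G hG
      apply edgeSet_injective
      rw [edgeSet_sup_fromEdgeSet_singleton _ he, edgeSet_deleteEdges]
      simpa using hG
    symm
    refine Finset.sum_bij' (fun G _ => G ⊔ fromEdgeSet {e}) (fun G _ => G.deleteEdges {e})
      ?_ ?_ ?_ ?_ ?_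
    · intro G hG
      simp only [Finset.mem_filter, Finset.mem_univ, true_and] at hG ⊢
      refine ⟨(hA G).2 hG.1, ?_⟩
      rw [edgeSet_sup_fromEdgeSet_singleton _ he]
      exact Set.mem_insert _ _
    · intro G hG
      simp only [Finset.mem_filter, Finset.mem_univ, true_and] at hG ⊢
      refine ⟨(hA _).1 (by rw [hdel G hG.2]; exact hG.1), ?_⟩
      simp [edgeSet_deleteEdges]
    · intro G hG
      simp only [Finset.mem_filter, Finset.mem_univ, true_and] at hG
      apply edgeSet_injective
      rw [edgeSet_deleteEdges, edgeSet_sup_fromEdgeSet_singleton _ he]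
      simpa using hG.2
    · intro G hG
      simp only [Finset.mem_filter, Finset.mem_univ, true_and] at hG
      exact hdel G hG.2
    · intro G hG
      simp only [Finset.mem_filter, Finset.mem_univ, true_and] at hG
      exact (real_singleton_sup p G he hG.2).symm
  have hsplit : (binomialRandom V p).real A = (binomialRandom V p).real {G | G ∈ A ∧ e ∈ G.edgeSet} +
      (binomialRandom V p).real {G | G ∈ A ∧ e ∉ G.edgeSet} := by
    rw [real_eq_sum, real_eq_sum p {G | G ∈ A ∧ e ∈ G.edgeSet},
      real_eq_sum p {G | G ∈ A ∧ e ∉ G.edgeSet}, ← Finset.sum_add_distrib]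
    refine Finset.sum_congr rfl fun G _ => ?_
    by_cases h1 : G ∈ A <;> by_cases h2 : e ∈ G.edgeSet <;> simp [h1, h2]
  rw [hsplit]
  linarith

/-- The probability that a prescribed set of pairs consists of edges. -/
lemma real_subset_edgeSet (p : unitInterval) (S : Finset (Sym2 V)) (hS : ∀ e ∈ S, ¬ e.IsDiag) :
    (binomialRandom V p).real {G | (S : Set (Sym2 V)) ⊆ G.edgeSet} = (p : ℝ) ^ S.card := by
  classical
  induction S using Finset.induction_on with
  | empty => simp
  | insert e S heS ih =>
    have he : ¬ e.IsDiag := hS e (Finset.mem_insert_self _ _)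
    rw [Finset.card_insert_of_notMem heS, pow_succ', ← ih fun f hf =>
      hS f (Finset.mem_insert_of_mem hf), ← real_inter_edge p he]
    · congr 1
      ext G
      simp [Set.insert_subset_iff, and_comm]
    · intro G
      simp only [Set.mem_ofPred_eq, edgeSet_sup_fromEdgeSet_singleton _ he]
      exact Set.subset_insert_iff_of_notMem (by simpa using heS)

/-- Adding one edge to the random graph changes probabilities by a factor of at most `p`. -/
lemma mul_real_sup_le (p : unitInterval) {e : Sym2 V} (he : ¬ e.IsDiag)
    (B : Set (SimpleGraph V)) :
    p * (binomialRandom V p).real {G | G ⊔ fromEdgeSet {e} ∈ B} ≤ (binomialRandom V p).real B := by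
  -- The event on the left ignores `e`, and on graphs containing `e` it coincides with `B`.
  rw [← real_inter_edge p he]
  · refine measureReal_mono ?_
    rintro G ⟨h1, h2⟩
    have : G ⊔ fromEdgeSet {e} = G := by
      apply edgeSet_injective
      rw [edgeSet_sup_fromEdgeSet_singleton _ he, Set.insert_eq_of_mem h2]
    rw [Set.mem_ofPred_eq, this] at h1
    exact h1
  · intro G
    simp

/-- Double counting: many events occurring on `B` make `B` unlikely. -/
lemma mul_real_le_sum (p : unitInterval) {ι : Type*} (Φ : Finset ι) (A : ι → Set (SimpleGraph V))
    (B : Set (SimpleGraph V)) (c : ℕ)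
    (h : ∀ G ∈ B, ∃ Ψ ⊆ Φ, c ≤ Ψ.card ∧ ∀ i ∈ Ψ, G ∈ A i) :
    c * (binomialRandom V p).real B ≤ ∑ i ∈ Φ, (binomialRandom V p).real (A i) := by
  classical
  rw [sum_real_eq_sum, real_eq_sum p B, Finset.mul_sum]
  refine Finset.sum_le_sum fun G _ => ?_
  by_cases hG : G ∈ B
  · obtain ⟨Ψ, hΨ, hc, hA⟩ := h G hG
    rw [if_pos hG]
    have := hc.trans (Finset.card_le_card fun i hi => Finset.mem_filter.2 ⟨hΨ hi, hA i hi⟩ :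
      Ψ.card ≤ (Φ.filter fun i => G ∈ A i).card)
    gcongr
  · rw [if_neg hG, mul_zero]
    positivity

/-- Double counting: events inside `B` of bounded multiplicity make `B` likely. -/
lemma sum_le_mul_real (p : unitInterval) {ι : Type*} (Φ : Finset ι) (A : ι → Set (SimpleGraph V))
    (B : Set (SimpleGraph V)) (c : ℕ) (hAB : ∀ i ∈ Φ, A i ⊆ B)
    (h : ∀ G ∈ B, ∀ Ψ ⊆ Φ, (∀ i ∈ Ψ, G ∈ A i) → Ψ.card ≤ c) :
    ∑ i ∈ Φ, (binomialRandom V p).real (A i) ≤ c * (binomialRandom V p).real B := by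
  classical
  rw [sum_real_eq_sum, real_eq_sum p B, Finset.mul_sum]
  refine Finset.sum_le_sum fun G _ => ?_
  by_cases hG : G ∈ B
  · rw [if_pos hG]
    have := h G hG (Φ.filter fun i => G ∈ A i) (Finset.filter_subset _ _)
      fun i hi => (Finset.mem_filter.1 hi).2
    gcongr
  · have : Φ.filter (fun i => G ∈ A i) = ∅ := by
      refine Finset.filter_eq_empty_iff.2 fun i hi hGi => hG (hAB i hi hGi)
    simp [this, hG]

end Probability

open scoped Classical

/-! ### Families of triples built one by one, and their expected number. -/

section

variable {V : Type*}

/-- The pairs joined by the triangle on an ordered triple. -/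
noncomputable def triEdges (t : Fin 3 → V) : Finset (Sym2 V) := {s(t 0, t 1), s(t 1, t 2), s(t 0, t 2)}

/-- The entries of an ordered triple. -/
noncomputable def triVerts (t : Fin 3 → V) : Finset V := Finset.univ.image t

noncomputable def famEdges {m : ℕ} (f : Fin m → Fin 3 → V) : Finset (Sym2 V) :=
  Finset.univ.biUnion fun i => triEdges (f i)

noncomputable def famVerts {m : ℕ} (f : Fin m → Fin 3 → V) : Finset V :=
  Finset.univ.biUnion fun i => triVerts (f i)

/-- The triples `f 0, f 1, …` are admissible in turn, each with respect to the vertices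
used before. -/
def SeqOK (ok : Finset V → (Fin 3 → V) → Prop) : (m : ℕ) → Finset V → (Fin m → Fin 3 → V) → Prop
  | 0, _, _ => True
  | m + 1, X, f => ok X (f 0) ∧ SeqOK ok m (X ∪ triVerts (f 0)) (Fin.tail f)

/-- Pairs within `X`, not too many of them. -/
def Within (X : Finset V) (S : Finset (Sym2 V)) : Prop :=
  (∀ e ∈ S, ∀ v ∈ e, v ∈ X) ∧ S.card ≤ 3 * X.card

lemma famEdges_succ {m : ℕ} (f : Fin (m + 1) → Fin 3 → V) :
    famEdges f = triEdges (f 0) ∪ famEdges (Fin.tail f) := by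
  ext e
  simp [famEdges, Fin.exists_fin_succ, Fin.tail]

lemma famVerts_succ {m : ℕ} (f : Fin (m + 1) → Fin 3 → V) :
    famVerts f = triVerts (f 0) ∪ famVerts (Fin.tail f) := by
  ext e
  simp [famVerts, Fin.exists_fin_succ, Fin.tail]

lemma mem_triVerts {t : Fin 3 → V} {v : V} : v ∈ triVerts t ↔ v = t 0 ∨ v = t 1 ∨ v = t 2 := by
  simp [triVerts, Fin.exists_fin_succ, eq_comm]

lemma mem_triEdges {t : Fin 3 → V} {e : Sym2 V} :
    e ∈ triEdges t ↔ e = s(t 0, t 1) ∨ e = s(t 1, t 2) ∨ e = s(t 0, t 2) := by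
  simp [triEdges]

lemma mem_triVerts_of_mem_triEdges {t : Fin 3 → V} {e : Sym2 V} (he : e ∈ triEdges t) {v : V}
    (hv : v ∈ e) : v ∈ triVerts t := by
  rw [mem_triEdges] at he
  rw [mem_triVerts]
  rcases he with rfl | rfl | rfl <;> rw [Sym2.mem_iff] at hv <;> tauto

lemma card_triEdges_le (t : Fin 3 → V) : (triEdges t).card ≤ 3 := Finset.card_le_three

/-- A triple brings at most three pairs and at least one new vertex. The resulting linear bound on
the number of prescribed pairs is what keeps the cost of a single vertex bounded in
`sum_singleOK_le`. -/
lemma Within.union {X : Finset V} {S : Finset (Sym2 V)} (h : Within X S) {t : Fin 3 → V}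
    (ht : X.card + 1 ≤ (X ∪ triVerts t).card) : Within (X ∪ triVerts t) (S ∪ triEdges t) := by
  refine ⟨fun e he v hv => ?_, ?_⟩
  · rw [Finset.mem_union] at he ⊢
    rcases he with he | he
    · exact Or.inl (h.1 e he v hv)
    · exact Or.inr (mem_triVerts_of_mem_triEdges he hv)
  · have h1 := Finset.card_union_le S (triEdges t)
    have h2 := card_triEdges_le t
    have h3 := h.2
    omega

lemma SeqOK.within {ok : Finset V → (Fin 3 → V) → Prop} {d : ℕ} (hd : 1 ≤ d)
    (hok : ∀ X t, ok X t → (X ∪ triVerts t).card = X.card + d) :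
    ∀ (m : ℕ) (X : Finset V) (S : Finset (Sym2 V)) (f : Fin m → Fin 3 → V), SeqOK ok m X f →
      Within X S → Within (X ∪ famVerts f) (S ∪ famEdges f) ∧
        (X ∪ famVerts f).card = X.card + d * m
  | 0, X, S, f, _, h => by simpa [famVerts, famEdges] using h
  | m + 1, X, S, f, hf, h => by
    obtain ⟨h0, h1⟩ := hf
    have hc := hok X _ h0
    have := SeqOK.within hd hok m _ _ _ h1 (h.union (by omega : X.card + 1 ≤ (X ∪ triVerts (f 0)).card))
    rw [Finset.union_assoc, Finset.union_assoc, ← famVerts_succ, ← famEdges_succ] at this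
    refine ⟨this.1, ?_⟩
    rw [this.2, hc]
    ring

lemma descFactorial_add (n a b : ℕ) :
    n.descFactorial (a + b) = n.descFactorial a * (n - a).descFactorial b := by
  induction b with
  | zero => simp
  | succ b ih => rw [← add_assoc, Nat.descFactorial_succ, Nat.descFactorial_succ, ih, Nat.sub_sub]; ring

variable [Fintype V]

/-- Expected number of admissible families of triangles, built up one by one. -/
lemma sum_pow_card_le {ok : Finset V → (Fin 3 → V) → Prop} {d : ℕ} (hd : 1 ≤ d)
    (hok : ∀ X t, ok X t → (X ∪ triVerts t).card = X.card + d) {p κ : ℝ} (hp : 0 ≤ p)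
    (hκ : 0 ≤ κ)
    (hstep : ∀ X S, Within X S → ∑ t with ok X t, p ^ (S ∪ triEdges t).card ≤
      p ^ S.card * ((Fintype.card V - X.card).descFactorial d * κ)) :
    ∀ (m : ℕ) (X : Finset V) (S : Finset (Sym2 V)), Within X S →
      ∑ f with SeqOK ok m X f, p ^ (S ∪ famEdges f).card ≤
        p ^ S.card * ((Fintype.card V - X.card).descFactorial (d * m) * κ ^ m)
  | 0, X, S, h => by
    simp [SeqOK, famEdges]
  | m + 1, X, S, h => by
    -- The first triple is split off and absorbed into `X` and `S`, which is why the induction needs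
    -- arbitrary starting sets.
    have e1 : ∑ f with SeqOK ok (m + 1) X f, p ^ (S ∪ famEdges f).card =
        ∑ t with ok X t, ∑ f with SeqOK ok m (X ∪ triVerts t) f,
          p ^ ((S ∪ triEdges t) ∪ famEdges f).card := by
      rw [Finset.sum_filter, ← (Fin.consEquiv fun _ => Fin 3 → V).sum_comp,
        Fintype.sum_prod_type, Finset.sum_filter]
      refine Finset.sum_congr rfl fun t _ => ?_
      rw [Finset.sum_filter]
      by_cases ht : ok X t
      · rw [if_pos ht]
        refine Finset.sum_congr rfl fun f _ => ?_
        have : Fin.tail (Fin.consEquiv (fun _ => Fin 3 → V) (t, f)) = f := rfl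
        simp [SeqOK, ht, famEdges_succ, Finset.union_assoc, this]
      · rw [if_neg ht]
        refine Finset.sum_eq_zero fun f _ => ?_
        simp [SeqOK, ht]
    rw [e1]
    calc ∑ t with ok X t, ∑ f with SeqOK ok m (X ∪ triVerts t) f,
          p ^ ((S ∪ triEdges t) ∪ famEdges f).card
        ≤ ∑ t with ok X t, p ^ (S ∪ triEdges t).card *
            ((Fintype.card V - (X.card + d)).descFactorial (d * m) * κ ^ m) := by
          refine Finset.sum_le_sum fun t ht => ?_
          have hc := hok X t (Finset.mem_filter.1 ht).2
          have := sum_pow_card_le hd hok hp hκ hstep m (X ∪ triVerts t) (S ∪ triEdges t)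
            (h.union (by omega))
          rwa [hc] at this
      _ ≤ p ^ S.card * ((Fintype.card V - X.card).descFactorial d * κ) *
            ((Fintype.card V - (X.card + d)).descFactorial (d * m) * κ ^ m) := by
          rw [← Finset.sum_mul]
          exact mul_le_mul_of_nonneg_right (hstep X S h) (by positivity)
      _ = _ := by
          rw [mul_add, mul_one, add_comm (d * m) d, descFactorial_add, Nat.sub_sub]
          push_cast
          ring

lemma sum_triple {M : Type*} [AddCommMonoid M] (F : (Fin 3 → V) → M) :
    ∑ t, F t = ∑ x, ∑ y, ∑ z, F ![x, y, z] := by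
  let e : V × V × V ≃ (Fin 3 → V) :=
    { toFun := fun q => ![q.1, q.2.1, q.2.2]
      invFun := fun t => (t 0, t 1, t 2)
      left_inv := fun q => by simp
      right_inv := fun t => by ext i; fin_cases i <;> rfl }
  rw [← e.sum_comp, Fintype.sum_prod_type]
  refine Finset.sum_congr rfl fun x _ => ?_
  rw [Fintype.sum_prod_type]
  rfl

/-- All three vertices are new. -/
def TriOK (X : Finset V) (t : Fin 3 → V) : Prop :=
  t 0 ∉ X ∧ t 1 ∉ X ∧ t 2 ∉ X ∧ t 0 ≠ t 1 ∧ t 0 ≠ t 2 ∧ t 1 ≠ t 2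

/-- Exactly the first two vertices are new. -/
def PairOK (X : Finset V) (t : Fin 3 → V) : Prop :=
  t 0 ∉ X ∧ t 1 ∉ X ∧ t 2 ∈ X ∧ t 0 ≠ t 1

/-- Exactly the first vertex is new. -/
def SingleOK (X : Finset V) (t : Fin 3 → V) : Prop :=
  t 0 ∉ X ∧ t 1 ∈ X ∧ t 2 ∈ X ∧ t 1 ≠ t 2

omit [Fintype V] in
lemma TriOK.card {X : Finset V} {t : Fin 3 → V} (h : TriOK X t) :
    (X ∪ triVerts t).card = X.card + 3 := by
  obtain ⟨h0, h1, h2, h01, h02, h12⟩ := h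
  have : X ∪ triVerts t = insert (t 0) (insert (t 1) (insert (t 2) X)) := by
    ext v
    simp only [Finset.mem_union, mem_triVerts, Finset.mem_insert]
    tauto
  rw [this, Finset.card_insert_of_notMem, Finset.card_insert_of_notMem,
    Finset.card_insert_of_notMem h2] <;> simp [*]

omit [Fintype V] in
lemma PairOK.card {X : Finset V} {t : Fin 3 → V} (h : PairOK X t) :
    (X ∪ triVerts t).card = X.card + 2 := by
  obtain ⟨h0, h1, h2, h01⟩ := h
  have : X ∪ triVerts t = insert (t 0) (insert (t 1) X) := by
    ext v
    simp only [Finset.mem_union, mem_triVerts, Finset.mem_insert]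
    constructor
    · rintro (h | h | h | rfl) <;> tauto
    · tauto
  rw [this, Finset.card_insert_of_notMem, Finset.card_insert_of_notMem h1]
  simp [*]

omit [Fintype V] in
lemma SingleOK.card {X : Finset V} {t : Fin 3 → V} (h : SingleOK X t) :
    (X ∪ triVerts t).card = X.card + 1 := by
  obtain ⟨h0, h1, h2, h12⟩ := h
  have : X ∪ triVerts t = insert (t 0) X := by
    ext v
    simp only [Finset.mem_union, mem_triVerts, Finset.mem_insert]
    constructor
    · rintro (h | h | rfl | rfl) <;> tauto
    · tauto
  rw [this, Finset.card_insert_of_notMem h0]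

omit [Fintype V] in
-- Every edge of the triangle contains `t 0` or `t 1`, hence a vertex outside `X`, so none is in
-- `S`. This serves `TriOK` and `PairOK` alike.
lemma card_union_triEdges_eq {X : Finset V} {S : Finset (Sym2 V)} (h : Within X S)
    {t : Fin 3 → V} (h0 : t 0 ∉ X) (h1 : t 1 ∉ X) (h01 : t 0 ≠ t 1) (h02 : t 0 ≠ t 2)
    (h12 : t 1 ≠ t 2) : (S ∪ triEdges t).card = S.card + 3 := by
  have e0 : ∀ v, s(t 0, v) ∉ S := fun v hv => h0 (h.1 _ hv _ (by simp))
  have e1 : ∀ v, s(t 1, v) ∉ S := fun v hv => h1 (h.1 _ hv _ (by simp))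
  have : S ∪ triEdges t = insert s(t 0, t 1) (insert s(t 1, t 2) (insert s(t 0, t 2) S)) := by
    ext v
    simp only [Finset.mem_union, mem_triEdges, Finset.mem_insert]
    tauto
  rw [this, Finset.card_insert_of_notMem, Finset.card_insert_of_notMem,
    Finset.card_insert_of_notMem (e0 _)] <;> simp [*, Ne.symm]

omit [Fintype V] in
-- The two edges at the new vertex are new, while the third lies within `X` and may already be
-- prescribed.
lemma card_union_triEdges_single {X : Finset V} {S : Finset (Sym2 V)} (h : Within X S)
    {t : Fin 3 → V} (ht : SingleOK X t) :
    (S ∪ triEdges t).card = S.card + if s(t 1, t 2) ∈ S then 2 else 3 := by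
  obtain ⟨h0, h1, h2, h12⟩ := ht
  have e0 : ∀ v, s(t 0, v) ∉ S := fun v hv => h0 (h.1 _ hv _ (by simp))
  have h01 : t 0 ≠ t 1 := fun h => h0 (h ▸ h1)
  have h02 : t 0 ≠ t 2 := fun h => h0 (h ▸ h2)
  have : S ∪ triEdges t = insert s(t 0, t 1) (insert s(t 0, t 2) (insert s(t 1, t 2) S)) := by
    ext v
    simp only [Finset.mem_union, mem_triEdges, Finset.mem_insert]
    tauto
  rw [this, Finset.card_insert_of_notMem, Finset.card_insert_of_notMem]
  · split_ifs with h
    · rw [Finset.insert_eq_of_mem h]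
    · rw [Finset.card_insert_of_notMem h]
  all_goals simp [*]

lemma sum_notMem (Y : Finset V) (c : ℝ) :
    ∑ v, (if v ∉ Y then c else 0) = ((Fintype.card V - Y.card : ℕ) : ℝ) * c := by
  rw [← Finset.sum_filter, Finset.sum_const, nsmul_eq_mul]
  congr 2
  rw [← Finset.card_compl]
  congr 1
  ext
  simp

lemma card_filter_triOK (X : Finset V) :
    ((Finset.univ.filter (TriOK X)).card : ℝ) =
      ((Fintype.card V - X.card).descFactorial 3 : ℝ) := by
  have h : ((Finset.univ.filter (TriOK X)).card : ℝ) =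
    ∑ x, if x ∉ X then (∑ y, if y ∉ insert x X then
      (∑ z, if z ∉ insert y (insert x X) then (1 : ℝ) else 0) else 0) else 0 := by
    rw [Finset.card_filter, Nat.cast_sum, sum_triple]
    refine Finset.sum_congr rfl fun x _ => ?_
    by_cases hx : x ∈ X
    · simp [TriOK, hx]
    · rw [if_pos hx]
      refine Finset.sum_congr rfl fun y _ => ?_
      by_cases hy : y ∈ insert x X
      · have : ∀ z, ¬ TriOK X ![x, y, z] := by
          rintro z ⟨h0, h1, h2, h3, -⟩
          rw [Finset.mem_insert] at hy
          rcases hy with rfl | hy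
          · exact h3 rfl
          · exact h1 hy
        simp [this, hy]
      · rw [if_pos hy]
        refine Finset.sum_congr rfl fun z _ => ?_
        simp only [Nat.cast_ite, Nat.cast_one, Nat.cast_zero]
        congr 1
        simp only [TriOK, Matrix.cons_val_zero, Matrix.cons_val_one, Matrix.cons_val, Finset.mem_insert, eq_iff_iff] at hy ⊢
        grind
  rw [h]
  calc _ = ∑ x, if x ∉ X then (∑ y, if y ∉ insert x X then
      ((Fintype.card V - (X.card + 2) : ℕ) : ℝ) else 0) else 0 := by
        refine Finset.sum_congr rfl fun x _ => ?_
        by_cases hx : x ∉ X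
        · rw [if_pos hx, if_pos hx]
          refine Finset.sum_congr rfl fun y _ => ?_
          by_cases hy : y ∉ insert x X
          · rw [if_pos hy, if_pos hy, sum_notMem, Finset.card_insert_of_notMem hy,
              Finset.card_insert_of_notMem hx, mul_one]
          · rw [if_neg hy, if_neg hy]
        · rw [if_neg hx, if_neg hx]
    _ = ∑ x, if x ∉ X then ((Fintype.card V - (X.card + 1) : ℕ) : ℝ) *
        ((Fintype.card V - (X.card + 2) : ℕ) : ℝ) else 0 := by
        refine Finset.sum_congr rfl fun x _ => ?_
        by_cases hx : x ∉ X
        · rw [if_pos hx, if_pos hx, sum_notMem, Finset.card_insert_of_notMem hx]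
        · rw [if_neg hx, if_neg hx]
    _ = _ := by
        rw [sum_notMem]
        simp only [Nat.descFactorial_succ, Nat.descFactorial_zero, Nat.sub_sub]
        push_cast
        ring_nf

lemma card_filter_pairOK (X : Finset V) :
    ((Finset.univ.filter (PairOK X)).card : ℝ) =
      ((Fintype.card V - X.card).descFactorial 2 : ℝ) * X.card := by
  have h : ((Finset.univ.filter (PairOK X)).card : ℝ) =
    ∑ x, if x ∉ X then (∑ y, if y ∉ insert x X then (X.card : ℝ) else 0) else 0 := by
    rw [Finset.card_filter, Nat.cast_sum, sum_triple]
    refine Finset.sum_congr rfl fun x _ => ?_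
    by_cases hx : x ∈ X
    · simp [PairOK, hx]
    · rw [if_pos hx]
      refine Finset.sum_congr rfl fun y _ => ?_
      by_cases hy : y ∈ insert x X
      · have : ∀ z, ¬ PairOK X ![x, y, z] := by
          rintro z ⟨h0, h1, h2, h3⟩
          rw [Finset.mem_insert] at hy
          rcases hy with rfl | hy
          · exact h3 rfl
          · exact h1 hy
        simp [this, hy]
      · rw [if_pos hy]
        have : ∀ z, PairOK X ![x, y, z] ↔ z ∈ X := by
          intro z
          simp only [PairOK, Matrix.cons_val_zero, Matrix.cons_val_one, Matrix.cons_val, Finset.mem_insert] at hy ⊢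
          grind
        simp [this]
  rw [h]
  calc _ = ∑ x, if x ∉ X then ((Fintype.card V - (X.card + 1) : ℕ) : ℝ) * X.card else 0 := by
        refine Finset.sum_congr rfl fun x _ => ?_
        by_cases hx : x ∉ X
        · rw [if_pos hx, if_pos hx, sum_notMem, Finset.card_insert_of_notMem hx]
        · rw [if_neg hx, if_neg hx]
    _ = _ := by
        rw [sum_notMem]
        simp only [Nat.descFactorial_succ, Nat.descFactorial_zero, Nat.sub_sub]
        push_cast
        ring_nf

/-- An unordered pair has at most two orderings. -/
lemma sum_sym2_mem_le (S : Finset (Sym2 V)) :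
    ∑ y : V, ∑ z : V, (if s(y, z) ∈ S then (1 : ℝ) else 0) ≤ 2 * S.card := by
  rw [← Fintype.sum_prod_type' fun y z => if s(y, z) ∈ S then (1 : ℝ) else 0, ← Finset.sum_filter,
    Finset.sum_const, nsmul_eq_mul, mul_one]
  have : (Finset.univ.filter fun q : V × V => s(q.1, q.2) ∈ S).card ≤ 2 * S.card := by
    refine Finset.card_le_mul_card_image_of_maps_to (f := fun q : V × V => s(q.1, q.2))
      (fun q hq => (Finset.mem_filter.1 hq).2) 2 fun e _ => ?_
    induction e using Sym2.ind with
    | _ x y =>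
      refine (Finset.card_le_card (t := {(x, y), (y, x)}) fun q hq => ?_).trans Finset.card_le_two
      have := (Finset.mem_filter.1 hq).2
      rw [Sym2.eq_iff] at this
      simp only [Finset.mem_insert, Finset.mem_singleton, Prod.ext_iff]
      exact this
  exact_mod_cast this

lemma sum_triOK_le {p : ℝ} (X : Finset V) (S : Finset (Sym2 V)) (h : Within X S) :
    ∑ t with TriOK X t, p ^ (S ∪ triEdges t).card ≤
      p ^ S.card * ((Fintype.card V - X.card).descFactorial 3 * p ^ 3) := by
  rw [← card_filter_triOK]
  refine le_of_eq ?_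
  rw [Finset.sum_congr rfl (g := fun _ => p ^ (S.card + 3))]
  · rw [Finset.sum_const, nsmul_eq_mul]
    ring
  · intro t ht
    obtain ⟨h0, h1, h2, h01, h02, h12⟩ := (Finset.mem_filter.1 ht).2
    rw [card_union_triEdges_eq h h0 h1 h01 h02 h12]

/-- Three new edges for two new vertices: the third factor `p` is paired with the at most `n`
choices of the old vertex. -/
lemma sum_pairOK_le {p : ℝ} (hp : 0 ≤ p) (X : Finset V) (S : Finset (Sym2 V)) (h : Within X S) :
    ∑ t with PairOK X t, p ^ (S ∪ triEdges t).card ≤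
      p ^ S.card * ((Fintype.card V - X.card).descFactorial 2 *
        (p ^ 2 * (Fintype.card V * p))) := by
  rw [Finset.sum_congr rfl (g := fun _ => p ^ (S.card + 3))]
  · rw [Finset.sum_const, nsmul_eq_mul, card_filter_pairOK]
    have : (X.card : ℝ) ≤ Fintype.card V := by exact_mod_cast Finset.card_le_univ X
    calc _ = p ^ S.card * ((Fintype.card V - X.card).descFactorial 2 *
        (p ^ 2 * (X.card * p))) := by ring
      _ ≤ _ := by gcongr
  · intro t ht
    obtain ⟨h0, h1, h2, h01⟩ := (Finset.mem_filter.1 ht).2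
    rw [card_union_triEdges_eq h h0 h1 h01 (fun h => h0 (h ▸ h2)) (fun h => h1 (h ▸ h2))]

/-- If the opposite edge is prescribed, there are at most `2 |S| ≤ 6 n` ordered choices and two new
edges. Otherwise there are at most `n ^ 2` choices and three new edges. Either way one factor `p`
remains, times a polynomial in `n p`. -/
lemma sum_singleOK_le {p : ℝ} (hp : 0 ≤ p) (X : Finset V) (S : Finset (Sym2 V))
    (h : Within X S) :
    ∑ t with SingleOK X t, p ^ (S ∪ triEdges t).card ≤
      p ^ S.card * ((Fintype.card V - X.card).descFactorial 1 *
        (p * (6 * (Fintype.card V * p) + (Fintype.card V * p) ^ 2))) := by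
  have hX : (X.card : ℝ) ≤ Fintype.card V := by exact_mod_cast Finset.card_le_univ X
  have hS : (S.card : ℝ) ≤ 3 * X.card := by exact_mod_cast h.2
  calc ∑ t with SingleOK X t, p ^ (S ∪ triEdges t).card
      ≤ ∑ t : Fin 3 → V, if t 0 ∉ X then
          p ^ (S.card + 2) * ((if s(t 1, t 2) ∈ S then 1 else 0) + p) else 0 := by
        rw [Finset.sum_filter]
        refine Finset.sum_le_sum fun t _ => ?_
        by_cases ht : SingleOK X t
        · rw [if_pos ht, if_pos ht.1, card_union_triEdges_single h ht]
          split_ifs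
          · have : 0 ≤ p ^ (S.card + 2) * p := by positivity
            linarith
          · exact le_of_eq (by ring)
        · rw [if_neg ht]
          split_ifs <;> positivity
    _ = ∑ x, if x ∉ X then p ^ (S.card + 2) *
          (∑ y : V, ∑ z : V, (if s(y, z) ∈ S then (1 : ℝ) else 0) + Fintype.card V ^ 2 * p)
          else 0 := by
        rw [sum_triple]
        refine Finset.sum_congr rfl fun x _ => ?_
        by_cases hx : x ∈ X
        · simp [hx]
        · simp only [Matrix.cons_val_zero, Matrix.cons_val_one, Matrix.cons_val, hx,
            not_false_eq_true, if_true, ← Finset.mul_sum, Finset.sum_add_distrib, Finset.sum_const,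
            Finset.card_univ, nsmul_eq_mul]
          ring_nf
          congr!
    _ ≤ ∑ x, if x ∉ X then p ^ (S.card + 2) *
          (6 * Fintype.card V + Fintype.card V ^ 2 * p) else 0 := by
        refine Finset.sum_le_sum fun x _ => ?_
        have := sum_sym2_mem_le S
        by_cases hx : x ∉ X
        · rw [if_pos hx, if_pos hx]
          refine mul_le_mul_of_nonneg_left ?_ (by positivity)
          linarith
        · rw [if_neg hx, if_neg hx]
    _ = _ := by
        rw [sum_notMem]
        simp only [Nat.descFactorial_one]
        ring

end

/-! ### Maximal families and the covering of all vertices in triangles. -/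

section

variable {V : Type*}

/-- `f` consists of triples that are admissible with respect to `X` and stay so in any order. -/
def Indep (ok : Finset V → (Fin 3 → V) → Prop) (X : Finset V) {m : ℕ} (f : Fin m → Fin 3 → V) :
    Prop :=
  (∀ i, ok X (f i)) ∧ ∀ i i', i ≠ i' → ∀ Y, ok Y (f i) → ok (Y ∪ triVerts (f i')) (f i)

/-- The triple spans a triangle of `G`. -/
def IsTri (G : SimpleGraph V) (t : Fin 3 → V) : Prop :=
  G.Adj (t 0) (t 1) ∧ G.Adj (t 1) (t 2) ∧ G.Adj (t 0) (t 2)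

lemma isTri_iff {G : SimpleGraph V} {t : Fin 3 → V} :
    IsTri G t ↔ (triEdges t : Set (Sym2 V)) ⊆ G.edgeSet := by
  simp [IsTri, triEdges, Set.insert_subset_iff]

lemma famEdges_subset_iff {G : SimpleGraph V} {m : ℕ} {f : Fin m → Fin 3 → V} :
    (famEdges f : Set (Sym2 V)) ⊆ G.edgeSet ↔ ∀ i, IsTri G (f i) := by
  simp [famEdges, isTri_iff]

lemma triVerts_subset_famVerts {m : ℕ} (f : Fin m → Fin 3 → V) (i : Fin m) :
    triVerts (f i) ⊆ famVerts f :=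
  Finset.subset_biUnion_of_mem (fun i => triVerts (f i)) (Finset.mem_univ i)

lemma apply_mem_triVerts (t : Fin 3 → V) (j : Fin 3) : t j ∈ triVerts t :=
  Finset.mem_image_of_mem t (Finset.mem_univ j)

/-- `Indep` is invariant under permutation, which gives the symmetry factors, whereas `SeqOK` is
recursive, which allows summation. This implication links the two. -/
lemma Indep.seqOK {ok : Finset V → (Fin 3 → V) → Prop} : ∀ {m : ℕ} {X : Finset V}
    {f : Fin m → Fin 3 → V}, Indep ok X f → SeqOK ok m X f
  | 0, _, _, _ => trivial
  | m + 1, X, f, h => by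
    refine ⟨h.1 0, Indep.seqOK ⟨fun i => ?_, fun i i' hi => ?_⟩⟩
    · exact h.2 i.succ 0 (Fin.succ_ne_zero i) X (h.1 i.succ)
    · exact h.2 i.succ i'.succ (by simpa using hi)

/-- Admissibility survives the addition of a triple that is admissible afterwards. -/
def Extendable (ok : Finset V → (Fin 3 → V) → Prop) : Prop :=
  ∀ X Z t t', triVerts t' ⊆ Z → ok X t → ok X t' → ok (X ∪ Z) t →
    (∀ Y, ok Y t → ok (Y ∪ triVerts t') t) ∧ ∀ Y, ok Y t' → ok (Y ∪ triVerts t) t'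

lemma Indep.cons {ok : Finset V → (Fin 3 → V) → Prop} (hok : Extendable ok) {m : ℕ} {X : Finset V}
    {f : Fin m → Fin 3 → V} (hf : Indep ok X f) {t : Fin 3 → V} (h1 : ok X t)
    (h2 : ok (X ∪ famVerts f) t) : Indep ok X (Fin.cons t f : Fin (m + 1) → Fin 3 → V) := by
  have key := fun i => hok X _ t (f i) (triVerts_subset_famVerts f i) h1 (hf.1 i) h2
  refine ⟨fun i => ?_, fun i i' => ?_⟩
  · refine Fin.cases ?_ (fun i => ?_) i
    · simpa using h1
    · simpa using hf.1 i
  · refine Fin.cases ?_ (fun i => ?_) i <;> refine Fin.cases ?_ (fun i' => ?_) i'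
    · simp
    · simpa using fun _ => (key i').1
    · simpa using (key i).2
    · intro h
      simpa using hf.2 i i' (by simpa using h)

lemma mem_triVerts_self (t : Fin 3 → V) : t 0 ∈ triVerts t ∧ t 1 ∈ triVerts t ∧ t 2 ∈ triVerts t :=
  ⟨apply_mem_triVerts t 0, apply_mem_triVerts t 1, apply_mem_triVerts t 2⟩

lemma extendable_triOK : Extendable (TriOK (V := V)) := by
  intro X Z t t' hZ h h' hXZ
  have e0 := hZ (mem_triVerts_self t').1
  have e1 := hZ (mem_triVerts_self t').2.1
  have e2 := hZ (mem_triVerts_self t').2.2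
  simp only [TriOK, Finset.mem_union, mem_triVerts, not_or] at *
  obtain ⟨a0, a1, a2, -⟩ := hXZ
  refine ⟨fun Y hY => ?_, fun Y hY => ?_⟩ <;> grind

/-- As in the other two cases, the new vertices of `t` avoid `Z`, hence `t'`. Conversely, the new
vertices of `t'` lie in `Z` but not in `X`, so they differ both from the new vertices of `t` and
from its old ones, which lie in `X`. -/
lemma extendable_pairOK : Extendable (PairOK (V := V)) := by
  intro X Z t t' hZ h h' hXZ
  have e0 := hZ (mem_triVerts_self t').1
  have e1 := hZ (mem_triVerts_self t').2.1
  have e2 := hZ (mem_triVerts_self t').2.2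
  simp only [PairOK, Finset.mem_union, mem_triVerts, not_or] at *
  obtain ⟨a0, a1, a2, -⟩ := hXZ
  refine ⟨fun Y hY => ?_, fun Y hY => ?_⟩ <;> grind

lemma extendable_singleOK : Extendable (SingleOK (V := V)) := by
  intro X Z t t' hZ h h' hXZ
  have e0 := hZ (mem_triVerts_self t').1
  have e1 := hZ (mem_triVerts_self t').2.1
  have e2 := hZ (mem_triVerts_self t').2.2
  simp only [SingleOK, Finset.mem_union, mem_triVerts, not_or] at *
  obtain ⟨a0, a1, a2, -⟩ := hXZ
  refine ⟨fun Y hY => ?_, fun Y hY => ?_⟩ <;> grind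

lemma SeqOK.card {ok : Finset V → (Fin 3 → V) → Prop} {d : ℕ} (hd : 1 ≤ d)
    (hok : ∀ X t, ok X t → (X ∪ triVerts t).card = X.card + d) {m : ℕ} {X : Finset V}
    {f : Fin m → Fin 3 → V} (h : SeqOK ok m X f) : (X ∪ famVerts f).card = X.card + d * m :=
  (h.within hd hok m X ∅ f ⟨by simp, by simp⟩).2

/-- Extension must stop, as `m` triples occupy `d * m ≥ m` new vertices. A triangle in the
maximality clause must be admissible for `X` itself: a pair, for instance, has to be attached to a
vertex of `X`, not to one of another pair. -/
lemma exists_maximal_family [Fintype V] {ok : Finset V → (Fin 3 → V) → Prop} {d : ℕ} (hd : 1 ≤ d)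
    (hcard : ∀ X t, ok X t → (X ∪ triVerts t).card = X.card + d) (hok : Extendable ok)
    (G : SimpleGraph V) (X : Finset V) :
    ∃ (m : ℕ) (f : Fin m → Fin 3 → V), Indep ok X f ∧ (∀ i, IsTri G (f i)) ∧
      ∀ t, IsTri G t → ok X t → ¬ ok (X ∪ famVerts f) t := by
  by_contra! hcon
  have key : ∀ m : ℕ, ∃ f : Fin m → Fin 3 → V, Indep ok X f ∧ ∀ i, IsTri G (f i) := by
    intro m
    induction m with
    | zero => exact ⟨fun i => i.elim0, ⟨fun i => i.elim0, fun i => i.elim0⟩, fun i => i.elim0⟩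
    | succ m ih =>
      obtain ⟨f, hf, hG⟩ := ih
      obtain ⟨t, ht, h1, h2⟩ := hcon m f hf hG
      refine ⟨Fin.cons t f, hf.cons hok h1 h2, fun i => ?_⟩
      refine Fin.cases ?_ (fun i => ?_) i
      · simpa using ht
      · simpa using hG i
  obtain ⟨f, hf, -⟩ := key (Fintype.card V + 1)
  have h1 := hf.seqOK.card hd hcard
  have h2 := Finset.card_le_univ (X ∪ famVerts f)
  nlinarith

/-- A vertex-disjoint family of triangles, a disjoint family of pairs completing triangles with
the first family, and single vertices completing triangles with the previous ones. -/
structure IsConfig (G : SimpleGraph V) {k b a : ℕ} (φ : Fin k → Fin 3 → V) (ψ : Fin b → Fin 3 → V)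
    (χ : Fin a → Fin 3 → V) : Prop where
  tri : Indep TriOK ∅ φ
  pair : Indep PairOK (famVerts φ) ψ
  single : Indep SingleOK (famVerts φ ∪ famVerts ψ) χ
  isTri_tri : ∀ i, IsTri G (φ i)
  isTri_pair : ∀ i, IsTri G (ψ i)
  isTri_single : ∀ i, IsTri G (χ i)

/-- Suppose a triangle `v y z` has `v` uncovered. If it misses `φ`, it extends `φ`. Otherwise let
`y` be in `φ`: if `z` is in `φ` or `ψ`, then `v` extends `χ`, and if not, the pair `v, z` extends
`ψ`. Each case contradicts a maximality. -/
lemma exists_isConfig [Fintype V] (G : SimpleGraph V) :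
    ∃ (k b a : ℕ) (φ : Fin k → Fin 3 → V) (ψ : Fin b → Fin 3 → V) (χ : Fin a → Fin 3 → V),
      IsConfig G φ ψ χ ∧ verticesInTriangles G ≤ 3 * k + 2 * b + a ∧
        3 * k + 2 * b + a ≤ Fintype.card V := by
  obtain ⟨k, φ, hφ, hφG, hφm⟩ := exists_maximal_family (by norm_num) (fun X t h => TriOK.card h)
    extendable_triOK G ∅
  obtain ⟨b, ψ, hψ, hψG, hψm⟩ := exists_maximal_family (by norm_num) (fun X t h => PairOK.card h)
    extendable_pairOK G (famVerts φ)
  obtain ⟨a, χ, hχ, hχG, hχm⟩ := exists_maximal_family le_rfl (fun X t h => SingleOK.card h)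
    extendable_singleOK G (famVerts φ ∪ famVerts ψ)
  have hcard : (famVerts φ ∪ famVerts ψ ∪ famVerts χ).card = 3 * k + 2 * b + a := by
    rw [hχ.seqOK.card le_rfl (fun X t h => SingleOK.card h),
      hψ.seqOK.card (by norm_num) (fun X t h => PairOK.card h)]
    have := hφ.seqOK.card (by norm_num) (fun X t h => TriOK.card h)
    simp only [Finset.empty_union, Finset.card_empty] at this
    rw [this]
    ring
  refine ⟨k, b, a, φ, ψ, χ, ⟨hφ, hψ, hχ, hφG, hψG, hχG⟩, ?_, ?_⟩
  · rw [← hcard, ← Set.ncard_coe_finset]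
    refine Set.ncard_le_ncard ?_ (Finset.finite_toSet _)
    rintro v ⟨y, z, hvy, hyz, hzv⟩
    by_contra hv
    simp only [Finset.coe_union, Set.mem_union, Finset.mem_coe, not_or] at hv
    obtain ⟨⟨hv1, hv2⟩, hv3⟩ := hv
    have key : ∀ y z, G.Adj v y → G.Adj y z → G.Adj z v → y ∈ famVerts φ → False := by
      intro y z hvy hyz hzv hy
      by_cases hz : z ∈ famVerts φ ∪ famVerts ψ
      · refine hχm ![v, z, y] ⟨hzv.symm, hyz.symm, hvy⟩ ?_ ?_
        · exact ⟨by simp [hv1, hv2], hz, by simp [hy], by simpa using hyz.ne'⟩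
        · refine ⟨by simp [hv1, hv2, hv3], ?_, by simp [hy], by simpa using hyz.ne'⟩
          exact Finset.mem_union_left _ hz
      · rw [Finset.mem_union, not_or] at hz
        refine hψm ![v, z, y] ⟨hzv.symm, hyz.symm, hvy⟩ ?_ ?_
        · exact ⟨by simp [hv1], by simp [hz.1], by simp [hy], by simpa using hzv.ne'⟩
        · exact ⟨by simp [hv1, hv2], by simp [hz], by simp [hy], by simpa using hzv.ne'⟩
    by_cases hy : y ∈ famVerts φ
    · exact key y z hvy hyz hzv hy
    by_cases hz : z ∈ famVerts φ
    · exact key z y hzv.symm hyz.symm hvy.symm hz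
    have h3 : v ≠ y ∧ v ≠ z ∧ y ≠ z := ⟨hvy.ne, hzv.ne', hyz.ne⟩
    refine hφm ![v, y, z] ⟨hvy, hyz, hzv.symm⟩ ?_ ?_
    · simpa [TriOK] using h3
    · simpa [TriOK, hv1, hy, hz] using h3
  · rw [← hcard]
    exact Finset.card_le_univ _

/-! ### Relabelling -/

lemma Indep.comp_perm {ok : Finset V → (Fin 3 → V) → Prop} {m : ℕ} {X : Finset V}
    {f : Fin m → Fin 3 → V} (h : Indep ok X f) (σ : Equiv.Perm (Fin m)) :
    Indep ok X (f ∘ σ) :=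
  ⟨fun i => h.1 (σ i), fun i i' hi => h.2 (σ i) (σ i') (by simpa using hi)⟩

lemma Indep.injective {ok : Finset V → (Fin 3 → V) → Prop} (hok : ∀ X t, ok X t → t 0 ∉ X)
    {m : ℕ} {X : Finset V} {f : Fin m → Fin 3 → V} (h : Indep ok X f) : Function.Injective f := by
  intro i i' hi
  by_contra hne
  have := hok _ _ (h.2 i i' hne X (h.1 i))
  rw [hi] at this
  exact this (Finset.mem_union_right _ (apply_mem_triVerts _ 0))

lemma famVerts_comp_perm {m : ℕ} (f : Fin m → Fin 3 → V) (σ : Equiv.Perm (Fin m)) :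
    famVerts (f ∘ σ) = famVerts f := by
  ext v
  simp only [famVerts, Finset.mem_biUnion, Finset.mem_univ, true_and, Function.comp]
  exact ⟨fun ⟨i, hi⟩ => ⟨σ i, hi⟩, fun ⟨i, hi⟩ => ⟨σ.symm i, by simpa using hi⟩⟩

lemma triVerts_comp_perm (t : Fin 3 → V) (τ : Equiv.Perm (Fin 3)) :
    triVerts (t ∘ τ) = triVerts t := by
  ext v
  simp only [triVerts, Finset.mem_image, Finset.mem_univ, true_and, Function.comp]
  exact ⟨fun ⟨i, hi⟩ => ⟨τ i, hi⟩, fun ⟨i, hi⟩ => ⟨τ.symm i, by simpa using hi⟩⟩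

lemma triOK_iff {X : Finset V} {t : Fin 3 → V} :
    TriOK X t ↔ (∀ j, t j ∉ X) ∧ Function.Injective t := by
  constructor
  · rintro ⟨h0, h1, h2, h01, h02, h12⟩
    refine ⟨fun j => by fin_cases j <;> assumption, fun i j hij => ?_⟩
    fin_cases i <;> fin_cases j <;> first | rfl | (exfalso; simp_all)
  · rintro ⟨h, hinj⟩
    exact ⟨h 0, h 1, h 2, hinj.ne (by decide), hinj.ne (by decide), hinj.ne (by decide)⟩

lemma TriOK.comp_perm {X : Finset V} {t : Fin 3 → V} (h : TriOK X t) (τ : Equiv.Perm (Fin 3)) :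
    TriOK X (t ∘ τ) := by
  rw [triOK_iff] at h ⊢
  exact ⟨fun j => h.1 (τ j), h.2.comp τ.injective⟩

lemma isTri_iff_forall {G : SimpleGraph V} {t : Fin 3 → V} :
    IsTri G t ↔ ∀ i j, i ≠ j → G.Adj (t i) (t j) := by
  constructor
  · rintro ⟨h01, h12, h02⟩ i j hij
    fin_cases i <;> fin_cases j <;>
      first | exact absurd rfl hij | assumption | (apply SimpleGraph.Adj.symm; assumption)
  · exact fun h => ⟨h 0 1 (by decide), h 1 2 (by decide), h 0 2 (by decide)⟩

lemma IsTri.comp_perm {G : SimpleGraph V} {t : Fin 3 → V} (h : IsTri G t)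
    (τ : Equiv.Perm (Fin 3)) : IsTri G (t ∘ τ) := by
  rw [isTri_iff_forall] at h ⊢
  exact fun i j hij => h _ _ (by simpa using hij)

/-- Reordering a family of triples, and the entries of each triple. -/
def relabel {k : ℕ} (φ : Fin k → Fin 3 → V) (g : Equiv.Perm (Fin k) × (Fin k → Equiv.Perm (Fin 3))) :
    Fin k → Fin 3 → V := fun i => φ (g.1 i) ∘ g.2 i

lemma famVerts_relabel {k : ℕ} (φ : Fin k → Fin 3 → V)
    (g : Equiv.Perm (Fin k) × (Fin k → Equiv.Perm (Fin 3))) :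
    famVerts (relabel φ g) = famVerts φ := by
  rw [← famVerts_comp_perm φ g.1]
  simp only [famVerts, relabel, triVerts_comp_perm, Function.comp]

lemma Indep.relabel {k : ℕ} {X : Finset V} {φ : Fin k → Fin 3 → V} (h : Indep TriOK X φ)
    (g : Equiv.Perm (Fin k) × (Fin k → Equiv.Perm (Fin 3))) :
    Indep TriOK X (RandomGraph.relabel φ g) := by
  refine ⟨fun i => (h.1 (g.1 i)).comp_perm _, fun i i' hi Y hY => ?_⟩
  have h1 := h.2 (g.1 i) (g.1 i') (by simpa using hi) Y ?_
  · have := h1.comp_perm (g.2 i)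
    rwa [RandomGraph.relabel, triVerts_comp_perm]
  · have := hY.comp_perm (g.2 i).symm
    rwa [RandomGraph.relabel, Function.comp_assoc, Equiv.self_comp_symm, Function.comp_id] at this

/-- All `3 * k` entries are distinct, so an entry determines its position. Hence distinct
relabellings give distinct families. -/
lemma Indep.apply_eq {k : ℕ} {X : Finset V} {φ : Fin k → Fin 3 → V} (h : Indep TriOK X φ)
    {i i' j j'} (hij : φ i j = φ i' j') : i = i' ∧ j = j' := by
  have hi : i = i' := by
    by_contra hne
    have := (triOK_iff.1 (h.2 i i' hne X (h.1 i))).1 j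
    rw [hij] at this
    exact this (Finset.mem_union_right _ (apply_mem_triVerts _ j'))
  subst hi
  exact ⟨rfl, (triOK_iff.1 (h.1 i)).2 hij⟩

lemma relabel_injective {k : ℕ} {X : Finset V} {φ : Fin k → Fin 3 → V} (h : Indep TriOK X φ) :
    Function.Injective (RandomGraph.relabel φ) := by
  rintro ⟨σ, τ⟩ ⟨σ', τ'⟩ heq
  have key : ∀ i j, σ i = σ' i ∧ τ i j = τ' i j := fun i j =>
    h.apply_eq (congrFun (congrFun heq i) j)
  ext i j
  · rw [(key i 0).1]
  · rw [(key i j).2]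

lemma card_relabel (k : ℕ) :
    Fintype.card (Equiv.Perm (Fin k) × (Fin k → Equiv.Perm (Fin 3))) = k.factorial * 6 ^ k := by
  simp [Fintype.card_perm, Nat.factorial]

/-! ### The first moment bound for configurations. -/

variable [Fintype V]

lemma real_subset_edgeSet_le (p : unitInterval) (S : Finset (Sym2 V)) :
    (binomialRandom V p).real {G | (S : Set (Sym2 V)) ⊆ G.edgeSet} ≤ (p : ℝ) ^ S.card := by
  by_cases hS : ∀ e ∈ S, ¬ e.IsDiag
  · exact (real_subset_edgeSet p S hS).le
  · push Not at hS
    obtain ⟨e, he, hd⟩ := hS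
    have : {G : SimpleGraph V | (S : Set (Sym2 V)) ⊆ G.edgeSet} = ∅ := by
      ext G
      simp only [Set.mem_ofPred_eq, Set.mem_empty_iff_false, iff_false]
      exact fun h => G.not_isDiag_of_mem_edgeSet (h he) hd
    rw [this]
    have := p.2.1
    simp only [measureReal_empty]
    positivity

/-- A configuration yields `k! 6^k b! a!` distinct ones: triangles may be reordered internally and
among themselves, while for pairs and single vertices permuting the triples suffices. The expected
number is summed over `χ`, then `ψ`, then `φ`, by `sum_pow_card_le` each time. -/
lemma real_isConfig_le (p : unitInterval) (k b a : ℕ) :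
    ((k.factorial * 6 ^ k * (b.factorial * a.factorial) : ℕ) : ℝ) *
      (binomialRandom V p).real {G | ∃ (φ : Fin k → Fin 3 → V) (ψ : Fin b → Fin 3 → V)
        (χ : Fin a → Fin 3 → V), IsConfig G φ ψ χ} ≤
    (Fintype.card V).descFactorial (3 * k + 2 * b + a) * (p : ℝ) ^ (3 * k + 2 * b + a) *
      (Fintype.card V * p : ℝ) ^ b *
      (6 * (Fintype.card V * p) + (Fintype.card V * p) ^ 2 : ℝ) ^ a := by
  have hp := p.2.1
  set n := Fintype.card V
  let Φ : Finset ((Fin k → Fin 3 → V) × (Fin b → Fin 3 → V) × (Fin a → Fin 3 → V)) :=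
    Finset.univ.filter fun c => SeqOK TriOK k ∅ c.1 ∧ SeqOK PairOK b (famVerts c.1) c.2.1 ∧
      SeqOK SingleOK a (famVerts c.1 ∪ famVerts c.2.1) c.2.2
  let A : (Fin k → Fin 3 → V) × (Fin b → Fin 3 → V) × (Fin a → Fin 3 → V) → Set (SimpleGraph V) :=
    fun c => {G | ((famEdges c.1 ∪ famEdges c.2.1 ∪ famEdges c.2.2 : Finset (Sym2 V)) :
      Set (Sym2 V)) ⊆ G.edgeSet}
  refine (mul_real_le_sum p Φ A _ _ ?_).trans ?_
  · rintro G ⟨φ, ψ, χ, h⟩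
    let F : (Equiv.Perm (Fin k) × (Fin k → Equiv.Perm (Fin 3))) ×
        (Equiv.Perm (Fin b) × Equiv.Perm (Fin a)) →
        (Fin k → Fin 3 → V) × (Fin b → Fin 3 → V) × (Fin a → Fin 3 → V) :=
      fun g => (relabel φ g.1, ψ ∘ g.2.1, χ ∘ g.2.2)
    have hF : Function.Injective F := by
      rintro ⟨g, σ, ρ⟩ ⟨g', σ', ρ'⟩ heq
      simp only [F, Prod.mk.injEq] at heq
      obtain ⟨h1, h2, h3⟩ := heq
      have e1 := relabel_injective h.tri h1
      have e2 : σ = σ' := Equiv.ext fun i =>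
        h.pair.injective (fun X t ht => ht.1) (congrFun h2 i)
      have e3 : ρ = ρ' := Equiv.ext fun i =>
        h.single.injective (fun X t ht => ht.1) (congrFun h3 i)
      rw [e1, e2, e3]
    refine ⟨Finset.univ.image F, ?_, ?_, ?_⟩
    · intro c hc
      obtain ⟨g, -, rfl⟩ := Finset.mem_image.1 hc
      refine Finset.mem_filter.2 ⟨Finset.mem_univ _, (h.tri.relabel g.1).seqOK, ?_, ?_⟩
      · simp only [F, famVerts_relabel]
        exact (h.pair.comp_perm _).seqOK
      · simp only [F, famVerts_relabel, famVerts_comp_perm]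
        exact (h.single.comp_perm _).seqOK
    · rw [Finset.card_image_of_injective _ hF, Finset.card_univ, Fintype.card_prod, card_relabel,
        Fintype.card_prod, Fintype.card_perm, Fintype.card_perm, Fintype.card_fin, Fintype.card_fin]
    · intro c hc
      obtain ⟨g, -, rfl⟩ := Finset.mem_image.1 hc
      simp only [A, F, Set.mem_ofPred_eq, Finset.coe_union, Set.union_subset_iff,
        famEdges_subset_iff]
      exact ⟨⟨fun i => (h.isTri_tri _).comp_perm _, fun i => h.isTri_pair _⟩,
        fun i => h.isTri_single _⟩
  · set l : ℝ := n * p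
    have hl : 0 ≤ l := by positivity
    calc ∑ c ∈ Φ, (binomialRandom V p).real (A c)
        ≤ ∑ c ∈ Φ, (p : ℝ) ^ (famEdges c.1 ∪ famEdges c.2.1 ∪ famEdges c.2.2).card :=
          Finset.sum_le_sum fun c _ => real_subset_edgeSet_le p _
      _ = ∑ φ with SeqOK TriOK k ∅ φ, ∑ ψ with SeqOK PairOK b (famVerts φ) ψ,
            ∑ χ with SeqOK SingleOK a (famVerts φ ∪ famVerts ψ) χ,
              (p : ℝ) ^ (famEdges φ ∪ famEdges ψ ∪ famEdges χ).card := by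
          simp only [Φ, Finset.sum_filter]
          rw [Fintype.sum_prod_type]
          refine Finset.sum_congr rfl fun φ _ => ?_
          rw [Fintype.sum_prod_type]
          by_cases h1 : SeqOK TriOK k ∅ φ
          · simp only [h1, true_and, if_true]
            refine Finset.sum_congr rfl fun ψ _ => ?_
            by_cases h2 : SeqOK PairOK b (famVerts φ) ψ
            · simp only [h2, true_and, if_true]
            · simp [h2]
          · simp [h1]
      _ ≤ ∑ φ with SeqOK TriOK k ∅ φ, ∑ ψ with SeqOK PairOK b (famVerts φ) ψ,
            (p : ℝ) ^ (famEdges φ ∪ famEdges ψ).card *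
              ((n - (3 * k + 2 * b)).descFactorial (1 * a) * ((p : ℝ) * (6 * l + l ^ 2)) ^ a) := by
          refine Finset.sum_le_sum fun φ hφ => Finset.sum_le_sum fun ψ hψ => ?_
          have h1 := (Finset.mem_filter.1 hφ).2.within (by norm_num) (fun X t h => TriOK.card h)
            k ∅ ∅ φ ⟨by simp, by simp⟩
          simp only [Finset.empty_union, Finset.card_empty] at h1
          have h2 := (Finset.mem_filter.1 hψ).2.within (by norm_num) (fun X t h => PairOK.card h)
            b _ _ ψ h1.1
          have := sum_pow_card_le le_rfl (fun X t h => SingleOK.card h) hp (by positivity)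
            (fun X S h => sum_singleOK_le hp X S h) a _ _ h2.1
          rwa [h2.2, h1.2, zero_add] at this
      _ ≤ ∑ φ with SeqOK TriOK k ∅ φ, (p : ℝ) ^ (famEdges φ).card *
            ((n - 3 * k).descFactorial (2 * b) * ((p : ℝ) ^ 2 * l) ^ b) *
              ((n - (3 * k + 2 * b)).descFactorial (1 * a) * ((p : ℝ) * (6 * l + l ^ 2)) ^ a) := by
          refine Finset.sum_le_sum fun φ hφ => ?_
          rw [← Finset.sum_mul]
          refine mul_le_mul_of_nonneg_right ?_ (by positivity)
          have h1 := (Finset.mem_filter.1 hφ).2.within (by norm_num) (fun X t h => TriOK.card h)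
            k ∅ ∅ φ ⟨by simp, by simp⟩
          simp only [Finset.empty_union, Finset.card_empty] at h1
          have := sum_pow_card_le (by norm_num) (fun X t h => PairOK.card h) hp (by positivity)
            (fun X S h => sum_pairOK_le hp X S h) b _ _ h1.1
          rwa [h1.2, zero_add] at this
      _ ≤ (n.descFactorial (3 * k) * ((p : ℝ) ^ 3) ^ k) *
            ((n - 3 * k).descFactorial (2 * b) * ((p : ℝ) ^ 2 * l) ^ b) *
              ((n - (3 * k + 2 * b)).descFactorial (1 * a) * ((p : ℝ) * (6 * l + l ^ 2)) ^ a) := by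
          rw [← Finset.sum_mul, ← Finset.sum_mul]
          refine mul_le_mul_of_nonneg_right (mul_le_mul_of_nonneg_right ?_ (by positivity))
            (by positivity)
          have := sum_pow_card_le (by norm_num) (fun X t h => TriOK.card h) hp (by positivity)
            (fun X S h => sum_triOK_le X S h) k (∅ : Finset V) ∅ ⟨by simp, by simp⟩
          simpa using this
      _ = _ := by
          rw [descFactorial_add n (3 * k + 2 * b) a, descFactorial_add n (3 * k) (2 * b)]
          rw [mul_pow (p : ℝ) (6 * l + l ^ 2) a]
          push_cast
          ring_nf

/-- First moment bound for the number of vertices in triangles. -/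
lemma real_le_verticesInTriangles_le (p : unitInterval) (q : ℕ) :
    (binomialRandom V p).real {G | q ≤ verticesInTriangles G} ≤
      ∑ k ∈ Finset.range (Fintype.card V + 1), ∑ b ∈ Finset.range (Fintype.card V + 1),
        ∑ a ∈ Finset.range (Fintype.card V + 1), if q ≤ 3 * k + 2 * b + a then
          (Fintype.card V).descFactorial (3 * k + 2 * b + a) * (p : ℝ) ^ (3 * k + 2 * b + a) *
            (Fintype.card V * p : ℝ) ^ b *
            (6 * (Fintype.card V * p) + (Fintype.card V * p) ^ 2 : ℝ) ^ a /
            (k.factorial * 6 ^ k * (b.factorial * a.factorial)) else 0 := by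
  set n := Fintype.card V
  let B : ℕ → ℕ → ℕ → Set (SimpleGraph V) := fun k b a =>
    {G | ∃ (φ : Fin k → Fin 3 → V) (ψ : Fin b → Fin 3 → V)
        (χ : Fin a → Fin 3 → V), IsConfig G φ ψ χ}
  -- Emptying the irrelevant events lets the union run over a full box of indices.
  let B' : ℕ → ℕ → ℕ → Set (SimpleGraph V) := fun k b a =>
    if q ≤ 3 * k + 2 * b + a then B k b a else ∅
  calc (binomialRandom V p).real {G | q ≤ verticesInTriangles G}
      ≤ (binomialRandom V p).real (⋃ k ∈ Finset.range (n + 1), ⋃ b ∈ Finset.range (n + 1),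
          ⋃ a ∈ Finset.range (n + 1), B' k b a) := by
        refine measureReal_mono (fun G hG => ?_) (measure_ne_top _ _)
        obtain ⟨k, b, a, φ, ψ, χ, h, h1, h2⟩ := exists_isConfig G
        have h3 : q ≤ 3 * k + 2 * b + a := le_trans hG h1
        simp only [Set.mem_iUnion, Finset.mem_range, exists_prop, B']
        refine ⟨k, by omega, b, by omega, a, by omega, ?_⟩
        rw [if_pos h3]
        exact ⟨φ, ψ, χ, h⟩
    _ ≤ ∑ k ∈ Finset.range (n + 1), ∑ b ∈ Finset.range (n + 1),
          ∑ a ∈ Finset.range (n + 1), (binomialRandom V p).real (B' k b a) := by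
        refine (measureReal_biUnion_finset_le _ _).trans (Finset.sum_le_sum fun k _ => ?_)
        refine (measureReal_biUnion_finset_le _ _).trans (Finset.sum_le_sum fun b _ => ?_)
        exact measureReal_biUnion_finset_le _ _
    _ ≤ _ := by
        refine Finset.sum_le_sum fun k _ => Finset.sum_le_sum fun b _ =>
          Finset.sum_le_sum fun a _ => ?_
        simp only [B']
        split_ifs with h
        · have := real_isConfig_le (V := V) p k b a
          rw [le_div_iff₀' (by positivity)]
          push_cast at this
          exact this
        · simp

end

/-! ### The lower bound: disjoint triangles with few others. -/

section

variable {V : Type*}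

lemma indep_triOK_of_injective {k : ℕ} {φ : Fin k → Fin 3 → V}
    (h : Function.Injective fun q : Fin k × Fin 3 => φ q.1 q.2) : Indep TriOK ∅ φ := by
  have hi : ∀ i, Function.Injective (φ i) := fun i j j' hj =>
    (Prod.ext_iff.1 (@h (i, j) (i, j') hj)).2
  refine ⟨fun i => triOK_iff.2 ⟨by simp, hi i⟩, fun i i' hne Y hY => triOK_iff.2 ⟨fun j => ?_, hi i⟩⟩
  rw [Finset.mem_union, not_or]
  refine ⟨(triOK_iff.1 hY).1 j, fun hj => hne ?_⟩
  simp only [triVerts, Finset.mem_image, Finset.mem_univ, true_and] at hj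
  obtain ⟨j', hj'⟩ := hj
  exact (Prod.ext_iff.1 (@h (i', j') (i, j) hj')).1.symm

lemma TriOK.card_triVerts {t : Fin 3 → V} (h : TriOK ∅ t) : (triVerts t).card = 3 := by
  simpa using h.card

lemma famEdges_not_isDiag {k : ℕ} {φ : Fin k → Fin 3 → V} (h : Indep TriOK ∅ φ) :
    ∀ e ∈ famEdges φ, ¬ e.IsDiag := by
  intro e he
  simp only [famEdges, Finset.mem_biUnion, Finset.mem_univ, true_and] at he
  obtain ⟨i, hi⟩ := he
  obtain ⟨-, -, -, h01, h02, h12⟩ := h.1 i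
  rw [mem_triEdges] at hi
  rcases hi with rfl | rfl | rfl <;> rw [Sym2.mk_isDiag_iff] <;> assumption

lemma exists_of_mem_famEdges {k : ℕ} {φ : Fin k → Fin 3 → V} {x y : V}
    (h : s(x, y) ∈ famEdges φ) : ∃ i, x ∈ triVerts (φ i) ∧ y ∈ triVerts (φ i) := by
  simp only [famEdges, Finset.mem_biUnion, Finset.mem_univ, true_and] at h
  obtain ⟨i, hi⟩ := h
  exact ⟨i, mem_triVerts_of_mem_triEdges hi (by simp), mem_triVerts_of_mem_triEdges hi (by simp)⟩

/-- The two edges share `y`, and the triples are disjoint, so both edges come from the same triple.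
-/
lemma eq_triVerts_of_mem_famEdges {k : ℕ} {φ : Fin k → Fin 3 → V} (h : Indep TriOK ∅ φ)
    {x y z : V} (hxy : x ≠ y) (hyz : y ≠ z) (hxz : x ≠ z) (h1 : s(x, y) ∈ famEdges φ)
    (h2 : s(y, z) ∈ famEdges φ) : ∃ i, triVerts (φ i) = {x, y, z} := by
  obtain ⟨i, hi1, hi2⟩ := exists_of_mem_famEdges h1
  obtain ⟨i', hi'1, hi'2⟩ := exists_of_mem_famEdges h2
  have : i = i' := by
    simp only [triVerts, Finset.mem_image, Finset.mem_univ, true_and] at hi2 hi'1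
    obtain ⟨j, hj⟩ := hi2
    obtain ⟨j', hj'⟩ := hi'1
    exact (h.apply_eq (hj.trans hj'.symm)).1
  subst this
  refine ⟨i, (Finset.eq_of_subset_of_card_le ?_ ?_).symm⟩
  · simp [Finset.insert_subset_iff, *]
  · rw [(h.1 i).card_triVerts, Finset.card_eq_three.2 ⟨x, y, z, hxy, hxz, hyz, rfl⟩]

/-- A triangle that does not belong to the family shares at most one edge with it. -/
lemma pow_card_union_triEdges_le {k : ℕ} {φ : Fin k → Fin 3 → V} (h : Indep TriOK ∅ φ)
    {t : Fin 3 → V} (ht : TriOK ∅ t) (hne : ∀ i, triVerts (φ i) ≠ triVerts t) {p : ℝ} (hp : 0 ≤ p)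
    (hp1 : p ≤ 1) :
    p ^ (famEdges φ ∪ triEdges t).card ≤ p ^ (famEdges φ).card * (p ^ 3 + p ^ 2 *
      ((if s(t 0, t 1) ∈ famEdges φ then 1 else 0) + (if s(t 1, t 2) ∈ famEdges φ then 1 else 0) +
        if s(t 0, t 2) ∈ famEdges φ then 1 else 0)) := by
  obtain ⟨-, -, -, h01, h02, h12⟩ := ht
  have htv : triVerts t = {t 0, t 1, t 2} := by
    ext v
    simp [mem_triVerts]
  have hA : ¬ (s(t 0, t 1) ∈ famEdges φ ∧ s(t 1, t 2) ∈ famEdges φ) := by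
    rintro ⟨h1, h2⟩
    obtain ⟨i, hi⟩ := eq_triVerts_of_mem_famEdges h h01 h12 h02 h1 h2
    exact hne i (hi.trans htv.symm)
  have hB : ¬ (s(t 0, t 1) ∈ famEdges φ ∧ s(t 0, t 2) ∈ famEdges φ) := by
    rintro ⟨h1, h2⟩
    rw [Sym2.eq_swap] at h1
    obtain ⟨i, hi⟩ := eq_triVerts_of_mem_famEdges h h01.symm h02 h12 h1 h2
    refine hne i (hi.trans ?_)
    rw [htv, Finset.insert_comm]
  have hC : ¬ (s(t 1, t 2) ∈ famEdges φ ∧ s(t 0, t 2) ∈ famEdges φ) := by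
    rintro ⟨h1, h2⟩
    rw [Sym2.eq_swap] at h1 h2
    rw [Sym2.eq_swap] at h1
    obtain ⟨i, hi⟩ := eq_triVerts_of_mem_famEdges h h12 h02.symm h01.symm h1 h2
    refine hne i (hi.trans ?_)
    rw [htv]
    ext v
    simp only [Finset.mem_insert, Finset.mem_singleton]
    tauto
  have n1 : s(t 0, t 1) ≠ s(t 1, t 2) := by simp [*]
  have n2 : s(t 0, t 1) ≠ s(t 0, t 2) := by simp [*]
  have n3 : s(t 1, t 2) ≠ s(t 0, t 2) := by simp [*, Ne.symm]
  have hcard : (famEdges φ ∪ triEdges t).card = (famEdges φ).card + (triEdges t \ famEdges φ).card := by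
    rw [add_comm, Finset.card_sdiff_add_card, Finset.union_comm]
  rw [hcard, pow_add]
  refine mul_le_mul_of_nonneg_left ?_ (by positivity)
  have h3 : 0 ≤ p ^ 3 := by positivity
  -- By `hA`, `hB` and `hC` at most one edge is shared, so two edges of `t` are always new.
  have two : ∀ e f : Sym2 V, e ≠ f → e ∈ triEdges t → f ∈ triEdges t → e ∉ famEdges φ →
      f ∉ famEdges φ → p ^ (triEdges t \ famEdges φ).card ≤ p ^ 2 := by
    intro e f hef he hf he' hf'
    refine pow_le_pow_of_le_one hp hp1 ?_
    rw [← Finset.card_pair hef]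
    refine Finset.card_le_card ?_
    simp [Finset.insert_subset_iff, *]
  by_cases c1 : s(t 0, t 1) ∈ famEdges φ
  · have := two _ _ n3 (by simp [triEdges]) (by simp [triEdges]) (by tauto) (by tauto)
    rw [if_pos c1, if_neg (by tauto), if_neg (by tauto)]
    linarith
  by_cases c2 : s(t 1, t 2) ∈ famEdges φ
  · have := two _ _ n2 (by simp [triEdges]) (by simp [triEdges]) (by tauto) (by tauto)
    rw [if_neg c1, if_pos c2, if_neg (by tauto)]
    linarith
  by_cases c3 : s(t 0, t 2) ∈ famEdges φ
  · have := two _ _ n1 (by simp [triEdges]) (by simp [triEdges]) (by tauto) (by tauto)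
    rw [if_neg c1, if_neg c2, if_pos c3]
    linarith
  rw [if_neg c1, if_neg c2, if_neg c3]
  have : triEdges t \ famEdges φ = triEdges t := by
    rw [Finset.sdiff_eq_self_iff_disjoint, Finset.disjoint_left]
    intro e he
    rw [mem_triEdges] at he
    rcases he with rfl | rfl | rfl <;> assumption
  rw [this]
  have : (triEdges t).card = 3 := Finset.card_eq_three.2 ⟨_, _, _, n1, n2, n3, rfl⟩
  rw [this]
  linarith

lemma card_famEdges_le {k : ℕ} (φ : Fin k → Fin 3 → V) : (famEdges φ).card ≤ 3 * k := by
  refine (Finset.card_biUnion_le_card_mul _ _ 3 fun i _ => card_triEdges_le _).trans ?_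
  simp [mul_comm]

lemma Indep.card_famVerts {k : ℕ} {φ : Fin k → Fin 3 → V} (h : Indep TriOK ∅ φ) :
    (famVerts φ).card = 3 * k := by
  simpa using h.seqOK.card (by norm_num) (fun X t h => TriOK.card h)

variable [Fintype V]

/-- The vertex sets of the triangles of `G`. -/
noncomputable def triangleSets (G : SimpleGraph V) : Finset (Finset V) :=
  (Finset.univ.filter (IsTri G)).image triVerts

omit [Fintype V] in
lemma IsTri.triOK {G : SimpleGraph V} {t : Fin 3 → V} (h : IsTri G t) : TriOK ∅ t :=
  triOK_iff.2 ⟨by simp, fun i j hij => by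
    by_contra hne
    exact (isTri_iff_forall.1 h i j hne).ne hij⟩

lemma card_le_verticesInTriangles {G : SimpleGraph V} {k : ℕ} {φ : Fin k → Fin 3 → V}
    (h : Indep TriOK ∅ φ) (hG : ∀ i, IsTri G (φ i)) : 3 * k ≤ verticesInTriangles G := by
  rw [← h.card_famVerts, ← Set.ncard_coe_finset]
  refine Set.ncard_le_ncard ?_ (Set.toFinite _)
  intro v hv
  simp only [famVerts, triVerts, Finset.coe_biUnion, Finset.coe_univ, Set.mem_univ, Set.iUnion_true,
    Set.mem_iUnion, Finset.mem_coe, Finset.mem_image, Finset.mem_univ, true_and] at hv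
  obtain ⟨i, j, rfl⟩ := hv
  have := isTri_iff_forall.1 (hG i)
  refine ⟨φ i (j + 1), φ i (j + 2), this _ _ ?_, this _ _ ?_, this _ _ ?_⟩ <;>
    fin_cases j <;> decide

lemma sum_triple' {M : Type*} [AddCommMonoid M] (F : V → V → V → M) :
    ∑ t : Fin 3 → V, F (t 0) (t 1) (t 2) = ∑ x, ∑ y, ∑ z, F x y z :=
  sum_triple fun t => F (t 0) (t 1) (t 2)

/-- At most `n ^ 3` ordered triples contribute three new edges. Those sharing an edge number at most
`3 * (2 |S|) * n ≤ 6 n ^ 2`, since `|S| ≤ 3 k ≤ n`, and contribute two. -/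
lemma sum_pow_card_other_le {k : ℕ} {φ : Fin k → Fin 3 → V} (h : Indep TriOK ∅ φ) {p : ℝ}
    (hp : 0 ≤ p) (hp1 : p ≤ 1) :
    ∑ t with TriOK ∅ t ∧ ∀ i, triVerts (φ i) ≠ triVerts t, p ^ (famEdges φ ∪ triEdges t).card ≤
      p ^ (famEdges φ).card * ((Fintype.card V * p) ^ 3 + 6 * (Fintype.card V * p) ^ 2) := by
  set S := famEdges φ
  have hS : (S.card : ℝ) ≤ Fintype.card V := by
    have h1 := card_famEdges_le φ
    have h2 := Finset.card_le_univ (famVerts φ)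
    rw [h.card_famVerts] at h2
    exact_mod_cast h1.trans h2
  have e01 : ∑ t : Fin 3 → V, (if s(t 0, t 1) ∈ S then (1 : ℝ) else 0) ≤
      Fintype.card V * (2 * S.card) := by
    refine (sum_triple' fun x y z => if s(x, y) ∈ S then (1 : ℝ) else 0).le.trans ?_
    simp only [Finset.sum_const, Finset.card_univ, nsmul_eq_mul, ← Finset.mul_sum]
    exact mul_le_mul_of_nonneg_left (sum_sym2_mem_le S) (Nat.cast_nonneg _)
  have e12 : ∑ t : Fin 3 → V, (if s(t 1, t 2) ∈ S then (1 : ℝ) else 0) ≤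
      Fintype.card V * (2 * S.card) := by
    refine (sum_triple' fun x y z => if s(y, z) ∈ S then (1 : ℝ) else 0).le.trans ?_
    simp only [Finset.sum_const, Finset.card_univ, nsmul_eq_mul]
    exact mul_le_mul_of_nonneg_left (sum_sym2_mem_le S) (Nat.cast_nonneg _)
  have e02 : ∑ t : Fin 3 → V, (if s(t 0, t 2) ∈ S then (1 : ℝ) else 0) ≤
      Fintype.card V * (2 * S.card) := by
    refine (sum_triple' fun x y z => if s(x, z) ∈ S then (1 : ℝ) else 0).le.trans ?_
    simp only [Finset.sum_const, Finset.card_univ, nsmul_eq_mul, ← Finset.mul_sum]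
    exact mul_le_mul_of_nonneg_left (sum_sym2_mem_le S) (Nat.cast_nonneg _)
  have e0 : ∑ t : Fin 3 → V, p ^ 3 = (Fintype.card V * p) ^ 3 := by
    simp
    ring
  calc ∑ t with TriOK ∅ t ∧ ∀ i, triVerts (φ i) ≠ triVerts t, p ^ (S ∪ triEdges t).card
      ≤ ∑ t with TriOK ∅ t ∧ ∀ i, triVerts (φ i) ≠ triVerts t, p ^ S.card * (p ^ 3 + p ^ 2 *
          ((if s(t 0, t 1) ∈ S then 1 else 0) + (if s(t 1, t 2) ∈ S then 1 else 0) +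
            if s(t 0, t 2) ∈ S then 1 else 0)) := by
        refine Finset.sum_le_sum fun t ht => ?_
        obtain ⟨h1, h2⟩ := (Finset.mem_filter.1 ht).2
        exact pow_card_union_triEdges_le h h1 h2 hp hp1
    _ ≤ ∑ t : Fin 3 → V, p ^ S.card * (p ^ 3 + p ^ 2 *
          ((if s(t 0, t 1) ∈ S then 1 else 0) + (if s(t 1, t 2) ∈ S then 1 else 0) +
            if s(t 0, t 2) ∈ S then 1 else 0)) := by
        refine Finset.sum_le_sum_of_subset_of_nonneg (Finset.filter_subset _ _) fun t _ _ => ?_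
        positivity
    _ ≤ _ := by
        rw [← Finset.mul_sum, Finset.sum_add_distrib, ← Finset.mul_sum, Finset.sum_add_distrib,
          Finset.sum_add_distrib, e0]
        refine mul_le_mul_of_nonneg_left ?_ (by positivity)
        have : (Fintype.card V : ℝ) * (2 * S.card) ≤ 2 * (Fintype.card V : ℝ) ^ 2 := by
          have : (0 : ℝ) ≤ Fintype.card V := by positivity
          nlinarith
        have h6 : p ^ 2 * (∑ t : Fin 3 → V, (if s(t 0, t 1) ∈ S then (1 : ℝ) else 0) +
            ∑ t : Fin 3 → V, (if s(t 1, t 2) ∈ S then (1 : ℝ) else 0) +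
            ∑ t : Fin 3 → V, (if s(t 0, t 2) ∈ S then (1 : ℝ) else 0)) ≤
            p ^ 2 * (6 * (Fintype.card V : ℝ) ^ 2) :=
          mul_le_mul_of_nonneg_left (by linarith) (by positivity)
        calc _ ≤ (Fintype.card V * p) ^ 3 + p ^ 2 * (6 * (Fintype.card V : ℝ) ^ 2) := by gcongr
          _ = _ := by ring

/-- A family of disjoint triangles is present, together with few other triangles. -/
def FewTriangles (M : ℕ) {k : ℕ} (φ : Fin k → Fin 3 → V) : Set (SimpleGraph V) :=
  {G | (∀ i, IsTri G (φ i)) ∧ (triangleSets G).card ≤ k + M}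

/-- Markov's inequality: by `hM`, the expected number of other triangles is at most `(M + 1) / 2`
times the probability of the family, so more than `M` others occur in at most half of that event. -/
lemma le_real_fewTriangles (p : unitInterval) {M : ℕ}
    (hM : 2 * ((Fintype.card V * p : ℝ) ^ 3 + 6 * (Fintype.card V * p : ℝ) ^ 2) ≤ M + 1) {k : ℕ}
    {φ : Fin k → Fin 3 → V} (h : Indep TriOK ∅ φ) :
    (p : ℝ) ^ (3 * k) / 2 ≤ (binomialRandom V p).real (FewTriangles M φ) := by
  have hp := p.2.1
  have hp1 := p.2.2
  set S := famEdges φ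
  have hall := real_subset_edgeSet p S (famEdges_not_isDiag h)
  have hbad : ((M + 1 : ℕ) : ℝ) * (binomialRandom V p).real
      {G | (∀ i, IsTri G (φ i)) ∧ k + M < (triangleSets G).card} ≤
      (p : ℝ) ^ S.card * ((Fintype.card V * p) ^ 3 + 6 * (Fintype.card V * p) ^ 2) := by
    refine (mul_real_le_sum p
      (Finset.univ.filter fun t => TriOK ∅ t ∧ ∀ i, triVerts (φ i) ≠ triVerts t)
      (fun t => {G | ((S ∪ triEdges t : Finset (Sym2 V)) : Set (Sym2 V)) ⊆ G.edgeSet})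
      _ _ ?_).trans ((Finset.sum_le_sum fun t _ => real_subset_edgeSet_le p _).trans
        (sum_pow_card_other_le h hp hp1))
    rintro G ⟨h1, h2⟩
    refine ⟨Finset.univ.filter fun t => IsTri G t ∧ ∀ i, triVerts (φ i) ≠ triVerts t, ?_, ?_, ?_⟩
    · intro t ht
      rw [Finset.mem_filter] at ht ⊢
      exact ⟨ht.1, ht.2.1.triOK, ht.2.2⟩
    · have hsub : triangleSets G ⊆ (Finset.univ.filter fun t => IsTri G t ∧
          ∀ i, triVerts (φ i) ≠ triVerts t).image triVerts ∪
          Finset.univ.image fun i => triVerts (φ i) := by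
        intro τ hτ
        obtain ⟨t, ht, rfl⟩ := Finset.mem_image.1 hτ
        rw [Finset.mem_union]
        by_cases hi : ∃ i, triVerts (φ i) = triVerts t
        · obtain ⟨i, hi⟩ := hi
          exact Or.inr (Finset.mem_image.2 ⟨i, Finset.mem_univ _, hi⟩)
        · push Not at hi
          exact Or.inl (Finset.mem_image_of_mem _ (Finset.mem_filter.2
            ⟨Finset.mem_univ _, (Finset.mem_filter.1 ht).2, hi⟩))
      have c1 := Finset.card_le_card hsub
      have c2 := Finset.card_union_le ((Finset.univ.filter fun t => IsTri G t ∧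
          ∀ i, triVerts (φ i) ≠ triVerts t).image triVerts)
          (Finset.univ.image fun i => triVerts (φ i))
      have c3 : (Finset.univ.image fun i => triVerts (φ i)).card ≤ k := by
        simpa using Finset.card_image_le (s := Finset.univ) (f := fun i => triVerts (φ i))
      have c4 := Finset.card_image_le (s := Finset.univ.filter fun t => IsTri G t ∧
          ∀ i, triVerts (φ i) ≠ triVerts t) (f := triVerts)
      omega
    · intro t ht
      simp only [Set.mem_ofPred_eq, Finset.coe_union, Set.union_subset_iff, S]
      exact ⟨famEdges_subset_iff.2 h1, isTri_iff.1 (Finset.mem_filter.1 ht).2.1⟩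
  have hsplit : (binomialRandom V p).real {G | (S : Set (Sym2 V)) ⊆ G.edgeSet} ≤
      (binomialRandom V p).real (FewTriangles M φ) +
      (binomialRandom V p).real {G | (∀ i, IsTri G (φ i)) ∧ k + M < (triangleSets G).card} := by
    refine (measureReal_mono (fun G hG => ?_) (measure_ne_top _ _)).trans (measureReal_union_le _ _)
    have hG' := famEdges_subset_iff.1 hG
    by_cases hc : (triangleSets G).card ≤ k + M
    · exact Or.inl ⟨hG', hc⟩
    · exact Or.inr ⟨hG', not_le.1 hc⟩
  rw [hall] at hsplit
  have hpow : (p : ℝ) ^ (3 * k) ≤ (p : ℝ) ^ S.card :=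
    pow_le_pow_of_le_one hp hp1 (card_famEdges_le φ)
  have hS0 : 0 ≤ (p : ℝ) ^ S.card := by positivity
  have hbad2 : (binomialRandom V p).real
      {G | (∀ i, IsTri G (φ i)) ∧ k + M < (triangleSets G).card} ≤ (p : ℝ) ^ S.card / 2 := by
    have hM0 : (0 : ℝ) < M + 1 := by positivity
    push_cast at hbad
    have : (M + 1 : ℝ) * (binomialRandom V p).real
      {G | (∀ i, IsTri G (φ i)) ∧ k + M < (triangleSets G).card} ≤
      (M + 1 : ℝ) * ((p : ℝ) ^ S.card / 2) := by
      refine hbad.trans ?_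
      have := mul_le_mul_of_nonneg_left hM hS0
      linarith
    exact le_of_mul_le_mul_left this hM0
  linarith

lemma card_filter_triVerts_eq_le (τ : Finset V) :
    (Finset.univ.filter fun t : Fin 3 → V => TriOK ∅ t ∧ triVerts t = τ).card ≤ 6 := by
  by_cases hτ : τ.card = 3
  · have h := card_filter_triOK τᶜ
    rw [← Finset.card_compl, compl_compl, hτ] at h
    have h' : (Finset.univ.filter (TriOK τᶜ)).card = 6 := by
      have : Nat.descFactorial 3 3 = 6 := by decide
      rw [this] at h
      exact_mod_cast h
    rw [← h']
    refine Finset.card_le_card fun t ht => ?_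
    obtain ⟨h1, rfl⟩ := (Finset.mem_filter.1 ht).2
    refine Finset.mem_filter.2 ⟨Finset.mem_univ _, triOK_iff.2 ⟨fun j => ?_, (triOK_iff.1 h1).2⟩⟩
    simpa using apply_mem_triVerts t j
  · rw [Finset.card_eq_zero.2]
    · norm_num
    · refine Finset.filter_eq_empty_iff.2 fun t _ ht => hτ ?_
      rw [← ht.2, ht.1.card_triVerts]

omit [Fintype V] in
lemma card_injective_le {k : ℕ} {α : Type*} [Fintype α] [DecidableEq α] (U : Finset α) :
    (Finset.univ.filter fun e : Fin k → α => Function.Injective e ∧ ∀ i, e i ∈ U).card ≤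
      U.card.descFactorial k := by
  have h : Fintype.card (Fin k ↪ U) = U.card.descFactorial k := by
    rw [Fintype.card_embedding_eq]
    simp
  rw [← h, ← Finset.card_univ]
  refine (Finset.card_le_card (t := Finset.univ.image fun (g : Fin k ↪ U) i => (g i : α)) ?_).trans
    Finset.card_image_le
  intro e he
  obtain ⟨h1, h2⟩ := (Finset.mem_filter.1 he).2
  exact Finset.mem_image.2 ⟨⟨fun i => ⟨e i, h2 i⟩, fun i j hij => h1 (Subtype.ext_iff.1 hij)⟩,
    Finset.mem_univ _, rfl⟩

lemma card_fiber_le {k : ℕ} (e : Fin k → Finset V) :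
    (Fintype.piFinset fun i =>
      Finset.univ.filter fun t : Fin 3 → V => TriOK ∅ t ∧ triVerts t = e i).card ≤ 6 ^ k := by
  rw [Fintype.card_piFinset]
  calc _ ≤ ∏ _i : Fin k, 6 := Finset.prod_le_prod' fun i _ => card_filter_triVerts_eq_le (e i)
    _ = 6 ^ k := by rw [Finset.prod_const, Finset.card_univ, Fintype.card_fin]

omit [Fintype V] in
lemma Indep.injective_triVerts {k : ℕ} {X : Finset V} {φ : Fin k → Fin 3 → V}
    (h : Indep TriOK X φ) : Function.Injective fun i => triVerts (φ i) := by
  intro i i' hi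
  have h0 := apply_mem_triVerts (φ i) 0
  rw [show triVerts (φ i) = triVerts (φ i') from hi] at h0
  obtain ⟨j, -, hj⟩ := Finset.mem_image.1 h0
  exact (h.apply_eq hj).1.symm

/-- A family is an injective sequence of vertex sets of triangles of `G`, of which there are at most
`k + M`, together with an order on each of them. -/
lemma card_families_le {M k : ℕ} (G : SimpleGraph V) (Ψ : Finset (Fin k → Fin 3 → V))
    (hΨ : ∀ φ ∈ Ψ, Indep TriOK ∅ φ ∧ G ∈ FewTriangles M φ) :
    Ψ.card ≤ 6 ^ k * (k + M).descFactorial k := by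
  rcases Ψ.eq_empty_or_nonempty with h | ⟨φ₀, hφ₀⟩
  · rw [h, Finset.card_empty]
    exact Nat.zero_le _
  have hM : (triangleSets G).card ≤ k + M := (hΨ φ₀ hφ₀).2.2
  let D : (Fin k → Fin 3 → V) → Fin k → Finset V := fun φ i => triVerts (φ i)
  have h1 : Ψ.card ≤ 6 ^ k * (Ψ.image D).card := by
    refine Finset.card_le_mul_card_image _ _ fun e _ => ?_
    refine (Finset.card_le_card ?_).trans (card_fiber_le e)
    intro φ hφ
    obtain ⟨hφ', he⟩ := Finset.mem_filter.1 hφ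
    exact Fintype.mem_piFinset.2 fun i => Finset.mem_filter.2
      ⟨Finset.mem_univ _, (hΨ φ hφ').1.1 i, congrFun he i⟩
  have h2 : (Ψ.image D).card ≤ (triangleSets G).card.descFactorial k := by
    refine (Finset.card_le_card ?_).trans (card_injective_le (triangleSets G))
    intro e he
    obtain ⟨φ, hφ, rfl⟩ := Finset.mem_image.1 he
    exact Finset.mem_filter.2 ⟨Finset.mem_univ _, (hΨ φ hφ).1.injective_triVerts, fun i =>
      Finset.mem_image_of_mem _ (Finset.mem_filter.2 ⟨Finset.mem_univ _, (hΨ φ hφ).2.1 i⟩)⟩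
  have h3 := Nat.descFactorial_le k hM
  exact h1.trans (Nat.mul_le_mul_left _ (h2.trans h3))

/-- The left side is `k! * (k+1)⋯(k+M) / M!`. For fixed `M` the loss against `k!` is polynomial in
`k`. -/
lemma descFactorial_add_le (k M : ℕ) :
    (k + M).descFactorial k ≤ k.factorial * (k + M) ^ M := by
  have h1 := Nat.factorial_mul_descFactorial (Nat.le_add_right k M)
  have h2 := Nat.factorial_mul_ascFactorial k M
  have h3 := Nat.ascFactorial_le_pow_add k M
  rw [Nat.add_sub_cancel_left, ← h2] at h1
  calc (k + M).descFactorial k ≤ M.factorial * (k + M).descFactorial k :=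
        Nat.le_mul_of_pos_left _ (Nat.factorial_pos M)
    _ = _ := h1
    _ ≤ _ := Nat.mul_le_mul_left _ h3

/-- Lower bound through families of disjoint triangles. -/
lemma descFactorial_mul_pow_le (p : unitInterval) {M : ℕ}
    (hM : 2 * ((Fintype.card V * p : ℝ) ^ 3 + 6 * (Fintype.card V * p : ℝ) ^ 2) ≤ M + 1) (k : ℕ) :
    (Fintype.card V).descFactorial (3 * k) * (p : ℝ) ^ (3 * k) ≤
      2 * (6 ^ k * (k.factorial * (k + M) ^ M)) *
        (binomialRandom V p).real {G | 3 * k ≤ verticesInTriangles G} := by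
  have hp := p.2.1
  let Φ : Finset (Fin k → Fin 3 → V) := Finset.univ.filter (Indep TriOK ∅)
  have hΦ : (Fintype.card V).descFactorial (3 * k) ≤ Φ.card := by
    have : Fintype.card (Fin k × Fin 3 ↪ V) = (Fintype.card V).descFactorial (3 * k) := by
      rw [Fintype.card_embedding_eq]
      simp [mul_comm]
    rw [← this, ← Finset.card_univ]
    refine Finset.card_le_card_of_injOn (fun g i j => g (i, j)) (fun g _ => ?_) fun g _ g' _ h => ?_
    · exact Finset.mem_coe.2 (Finset.mem_filter.2
        ⟨Finset.mem_univ _, indep_triOK_of_injective g.injective⟩)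
    · ext ⟨i, j⟩
      exact congrFun (congrFun h i) j
  have h1 : (Φ.card : ℝ) * ((p : ℝ) ^ (3 * k) / 2) ≤
      ∑ φ ∈ Φ, (binomialRandom V p).real (FewTriangles M φ) := by
    rw [← nsmul_eq_mul]
    exact Finset.card_nsmul_le_sum _ _ _ fun φ hφ =>
      le_real_fewTriangles p hM (Finset.mem_filter.1 hφ).2
  have h2 := sum_le_mul_real p Φ (FewTriangles M) {G | 3 * k ≤ verticesInTriangles G}
    (6 ^ k * (k + M).descFactorial k)
    (fun φ hφ G hG => card_le_verticesInTriangles (Finset.mem_filter.1 hφ).2 hG.1)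
    (fun G _ Ψ hΨ hG => card_families_le (M := M) G Ψ fun φ hφ =>
      ⟨(Finset.mem_filter.1 (hΨ hφ)).2, hG φ hφ⟩)
  have h3 : ((6 ^ k * (k + M).descFactorial k : ℕ) : ℝ) ≤ 6 ^ k * (k.factorial * (k + M) ^ M) := by
    exact_mod_cast Nat.mul_le_mul_left _ (descFactorial_add_le k M)
  have h4 : ((Fintype.card V).descFactorial (3 * k) : ℝ) * ((p : ℝ) ^ (3 * k) / 2) ≤
      Φ.card * ((p : ℝ) ^ (3 * k) / 2) := by gcongr
  have h5 := mul_le_mul_of_nonneg_right h3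
    (measureReal_nonneg (μ := binomialRandom V p) (s := {G | 3 * k ≤ verticesInTriangles G}))
  linarith

/-- One more vertex in triangles is obtained by adding two edges. -/
lemma sq_mul_real_le (p : unitInterval) {q : ℕ} (hq : 1 ≤ q) (hqn : q < Fintype.card V) :
    (p : ℝ) ^ 2 * (binomialRandom V p).real {G | q ≤ verticesInTriangles G} ≤
      (1 + (Fintype.card V : ℝ) ^ 3) *
        (binomialRandom V p).real {G | q + 1 ≤ verticesInTriangles G} := by
  have hp := p.2.1
  have hp1 := p.2.2
  set B : Set (SimpleGraph V) := {G | q + 1 ≤ verticesInTriangles G}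
  let C : V × V × V → Set (SimpleGraph V) := fun c =>
    if c.1 ≠ c.2.1 ∧ c.1 ≠ c.2.2 then
      {G | G ⊔ fromEdgeSet {s(c.1, c.2.1)} ⊔ fromEdgeSet {s(c.1, c.2.2)} ∈ B} else ∅
  have hC : ∀ c, (p : ℝ) ^ 2 * (binomialRandom V p).real (C c) ≤ (binomialRandom V p).real B := by
    intro c
    simp only [C]
    split_ifs with hc
    · have h1 := mul_real_sup_le p (e := s(c.1, c.2.2)) (by simpa using hc.2) B
      have h2 := mul_real_sup_le p (e := s(c.1, c.2.1)) (by simpa using hc.1)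
        {G | G ⊔ fromEdgeSet {s(c.1, c.2.2)} ∈ B}
      calc _ = (p : ℝ) * (p * (binomialRandom V p).real
            {G | G ⊔ fromEdgeSet {s(c.1, c.2.1)} ∈ {G | G ⊔ fromEdgeSet {s(c.1, c.2.2)} ∈ B}}) := by
            rw [sq, mul_assoc]
            rfl
        _ ≤ _ := (mul_le_mul_of_nonneg_left h2 hp).trans h1
    · simp
  -- If `V_T = q` exactly, then `hqn` provides a vertex `v` in no triangle and `hq` an existing
  -- triangle. Joining `v` to both ends of an edge of that triangle adds `v`. The union over the `n
  -- ^ 3` choices, plus `B` itself, gives the factor `1 + n ^ 3`.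
  have hsub : {G : SimpleGraph V | q ≤ verticesInTriangles G} ⊆ B ∪ ⋃ c ∈ Finset.univ, C c := by
    intro G hG
    rw [Set.mem_ofPred_eq] at hG
    by_cases hGB : q + 1 ≤ verticesInTriangles G
    · exact Or.inl hGB
    right
    have hGq : verticesInTriangles G = q := by omega
    set T : Set V := {v : V | ∃ u w : V, G.Adj v u ∧ G.Adj u w ∧ G.Adj w v}
    have hT : T.ncard = q := hGq
    obtain ⟨v, hv⟩ : ∃ v, v ∉ T := by
      by_contra! hall
      have : T = Set.univ := Set.eq_univ_of_forall hall
      rw [this, Set.ncard_univ, Nat.card_eq_fintype_card] at hT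
      omega
    obtain ⟨u, hu⟩ : T.Nonempty := Set.nonempty_of_ncard_ne_zero (by omega)
    obtain ⟨w, x, huw, hwx, hxu⟩ := id hu
    have hw : w ∈ T := ⟨x, u, hwx, hxu, huw⟩
    have hvu : v ≠ u := fun h => hv (h ▸ hu)
    have hvw : v ≠ w := fun h => hv (h ▸ hw)
    simp only [Finset.mem_univ, Set.iUnion_true, Set.mem_iUnion]
    refine ⟨(v, u, w), ?_⟩
    simp only [C]
    rw [if_pos ⟨hvu, hvw⟩]
    set G' := G ⊔ fromEdgeSet {s(v, u)} ⊔ fromEdgeSet {s(v, w)}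
    have hle : G ≤ G' := le_sup_left.trans le_sup_left
    have h1 : G'.Adj v u := by simp [G', hvu]
    have h2 : G'.Adj w v := by simp [G', hvw.symm, Sym2.eq_swap]
    change q + 1 ≤ _
    rw [← hT, ← Set.ncard_insert_of_notMem hv]
    refine Set.ncard_le_ncard ?_ (Set.toFinite _)
    refine Set.insert_subset ⟨u, w, h1, hle huw, h2⟩ ?_
    rintro y ⟨z, z', a1, a2, a3⟩
    exact ⟨z, z', hle a1, hle a2, hle a3⟩
  have hle := (measureReal_mono (μ := binomialRandom V p) hsub (measure_ne_top _ _)).trans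
    ((measureReal_union_le _ _).trans
      (add_le_add_right (measureReal_biUnion_finset_le _ _) _))
  have hsum : (p : ℝ) ^ 2 * ∑ c, (binomialRandom V p).real (C c) ≤
      (Fintype.card V : ℝ) ^ 3 * (binomialRandom V p).real B := by
    rw [Finset.mul_sum]
    refine (Finset.sum_le_sum fun c _ => hC c).trans (le_of_eq ?_)
    rw [Finset.sum_const, nsmul_eq_mul, Finset.card_univ, Fintype.card_prod, Fintype.card_prod]
    push_cast
    ring
  have hp2 : (p : ℝ) ^ 2 ≤ 1 := pow_le_one₀ hp hp1
  have hB : 0 ≤ (binomialRandom V p).real B := measureReal_nonneg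
  calc _ ≤ (p : ℝ) ^ 2 * ((binomialRandom V p).real B + ∑ c, (binomialRandom V p).real (C c)) :=
        mul_le_mul_of_nonneg_left hle (by positivity)
    _ ≤ _ := by nlinarith

end

/-! ### Comparison of both bounds with the main term. -/

instance (lam : ℝ) (n : ℕ) : IsProbabilityMeasure (erdosRenyi lam n) :=
  inferInstanceAs (IsProbabilityMeasure (binomialRandom (Fin n) (edgeProb lam n)))

/-- The right-hand side, with `q / 3` rounded down. -/
noncomputable def mainTerm (lam : ℝ) (n q : ℕ) : ℝ :=
  n.descFactorial q * (lam / n) ^ q / (6 ^ (q / 3) * (q / 3).factorial)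

lemma coe_edgeProb {lam : ℝ} (hlam : 0 < lam) {n : ℕ} (hn : lam ≤ n) :
    (edgeProb lam n : ℝ) = lam / n := by
  have hn0 : (0 : ℝ) < n := hlam.trans_le hn
  rw [edgeProb, Set.projIcc_of_mem zero_le_one ⟨by positivity, (div_le_one hn0).2 hn⟩]

/-- Each vertex beyond `q` contributes at most `n * (lam / n) = lam`. -/
lemma descFactorial_mul_pow_add_le {lam L : ℝ} (hlam : 0 < lam) (hL : lam ≤ L) {n : ℕ} (hn : 0 < n)
    (q s : ℕ) :
    n.descFactorial (q + s) * (lam / n) ^ (q + s) ≤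
      n.descFactorial q * (lam / n) ^ q * L ^ s := by
  have hn' : (0 : ℝ) < n := by exact_mod_cast hn
  have h1 : ((n - q).descFactorial s : ℝ) ≤ (n : ℝ) ^ s := by
    have := (Nat.descFactorial_le_pow (n - q) s).trans (Nat.pow_le_pow_left (Nat.sub_le n q) s)
    exact_mod_cast this
  rw [descFactorial_add, pow_add]
  push_cast
  calc _ = n.descFactorial q * (lam / n) ^ q * ((n - q).descFactorial s * (lam / n) ^ s) := by ring
    _ ≤ n.descFactorial q * (lam / n) ^ q * ((n : ℝ) ^ s * (lam / n) ^ s) := by gcongr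
    _ = n.descFactorial q * (lam / n) ^ q * lam ^ s := by
        rw [← mul_pow, mul_div_cancel₀ _ hn'.ne']
    _ ≤ _ := by gcongr

lemma factorial_add_le (k j : ℕ) : (k + j).factorial ≤ k.factorial * (k + j) ^ j := by
  rw [← Nat.factorial_mul_ascFactorial]
  exact Nat.mul_le_mul_left _ (Nat.ascFactorial_le_pow_add k j)

lemma pow_le_factorial_mul_exp {x : ℝ} (hx : 0 ≤ x) (m : ℕ) :
    x ^ m ≤ m.factorial * Real.exp x := by
  have := Real.pow_div_factorial_le_exp x hx m
  rwa [div_le_iff₀' (by positivity)] at this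

/-- Replacing triangles by other configurations does not pay off, up to a subexponential factor. -/
lemma pow_mul_factorial_le {L N : ℝ} (hL : 1 ≤ L) (hN : 1 ≤ N) {n q k b a : ℕ} (hqn : q ≤ n)
    (hNn : 6 * (n : ℝ) ≤ N ^ 3) (hq : q ≤ 3 * k + 2 * b + a) :
    L ^ (3 * k + 2 * b + a - q) * (6 ^ (q / 3) * (q / 3).factorial) ≤
      6 ^ k * k.factorial * Real.exp (L ^ 3) * ((N * L) ^ (2 * b + a)) := by
  have hNL : L ^ (2 * b + a) ≤ (N * L) ^ (2 * b + a) :=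
    pow_le_pow_left₀ (by positivity) (le_mul_of_one_le_left (by positivity) hN) _
  rcases le_total (q / 3) k with h | h
  -- Too many triangles: the surplus `L ^ (3 * j)` is at most `j! * exp (L ^ 3)`, and `j!` is
  -- absorbed by `(K + j)!`.
  · obtain ⟨j, rfl⟩ := Nat.exists_eq_add_of_le h
    set K := q / 3 with hK
    have e1 : L ^ (3 * (K + j) + 2 * b + a - q) ≤ (L ^ 3) ^ j * L ^ (2 * b + a) := by
      rw [← pow_mul, ← pow_add]
      exact pow_le_pow_right₀ hL (by omega)
    have e2 : (K.factorial * j.factorial : ℝ) ≤ (K + j).factorial := by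
      exact_mod_cast Nat.le_of_dvd (Nat.factorial_pos _) (Nat.factorial_mul_factorial_dvd_factorial_add K j)
    have e3 := pow_le_factorial_mul_exp (show 0 ≤ L ^ 3 by positivity) j
    have e4 : (6 : ℝ) ^ K ≤ 6 ^ (K + j) := pow_le_pow_right₀ (by norm_num) (by omega)
    calc _ ≤ ((j.factorial * Real.exp (L ^ 3)) * (N * L) ^ (2 * b + a)) *
          (6 ^ (K + j) * K.factorial) := by
          gcongr
          exact e1.trans (by gcongr)
      _ = 6 ^ (K + j) * (K.factorial * j.factorial) * Real.exp (L ^ 3) * (N * L) ^ (2 * b + a) := by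
          ring
      _ ≤ _ := by gcongr
  -- Too few triangles: `j` are missing, which gains at most `(6 n) ^ j ≤ N ^ (3 * j)`, and `3 * j ≤
  -- 2 * b + a` because the other vertices must make up for them.
  · obtain ⟨j, hj⟩ := Nat.exists_eq_add_of_le h
    have e1 : L ^ (3 * k + 2 * b + a - q) ≤ L ^ (2 * b + a) := pow_le_pow_right₀ hL (by omega)
    have e2 : ((k + j).factorial : ℝ) ≤ k.factorial * (k + j : ℝ) ^ j := by
      exact_mod_cast factorial_add_le k j
    have e3 : (k + j : ℝ) ≤ n := by
      exact_mod_cast (by omega : k + j ≤ n)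
    have e4 : (6 * (k + j : ℝ)) ^ j ≤ N ^ (2 * b + a) := by
      calc (6 * (k + j : ℝ)) ^ j ≤ (N ^ 3) ^ j :=
            pow_le_pow_left₀ (by positivity) (by linarith) _
        _ = N ^ (3 * j) := by rw [pow_mul]
        _ ≤ _ := pow_le_pow_right₀ hN (by omega)
    have e5 : 1 ≤ Real.exp (L ^ 3) := Real.one_le_exp (by positivity)
    rw [hj]
    calc _ ≤ L ^ (2 * b + a) * (6 ^ (k + j) * (k.factorial * (k + j : ℝ) ^ j)) := by gcongr
      _ = 6 ^ k * k.factorial * 1 * ((6 * (k + j : ℝ)) ^ j * L ^ (2 * b + a)) := by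
          rw [mul_pow, pow_add]
          ring
      _ ≤ 6 ^ k * k.factorial * Real.exp (L ^ 3) * (N ^ (2 * b + a) * L ^ (2 * b + a)) := by gcongr
      _ = _ := by rw [mul_pow]

/-- The factor `(N L)^(2b+a)` allots `(N L)^2` to each pair and `N L` to each single vertex. Since
`x ^ b / b! ≤ exp x`, powers become exponentials. With `N` of order `n^(1/3)` the pairs dominate and
yield the exponent `n^(2/3)`. -/
lemma term_le_mainTerm {lam L N : ℝ} (hlam : 0 < lam) (hlL : lam ≤ L) (hL : 1 ≤ L) (hN : 1 ≤ N)
    {n q k b a : ℕ} (hn : 0 < n) (hqn : q ≤ n) (hNn : 6 * (n : ℝ) ≤ N ^ 3)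
    (hq : q ≤ 3 * k + 2 * b + a) :
    n.descFactorial (3 * k + 2 * b + a) * (lam / n) ^ (3 * k + 2 * b + a) * lam ^ b *
        (6 * lam + lam ^ 2) ^ a / (k.factorial * 6 ^ k * (b.factorial * a.factorial)) ≤
      mainTerm lam n q *
        Real.exp (L ^ 3 + (N * L) ^ 2 * lam + N * L * (6 * lam + lam ^ 2)) := by
  set y := 6 * lam + lam ^ 2
  have hy : 0 ≤ y := by positivity
  have h1 := descFactorial_mul_pow_add_le hlam hlL hn q (3 * k + 2 * b + a - q)
  rw [Nat.add_sub_cancel' hq] at h1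
  have h2 := pow_mul_factorial_le hL hN hqn hNn hq
  have h3 := pow_le_factorial_mul_exp (show 0 ≤ (N * L) ^ 2 * lam by positivity) b
  have h4 := pow_le_factorial_mul_exp (show 0 ≤ N * L * y by positivity) a
  rw [mainTerm, div_mul_eq_mul_div, div_le_div_iff₀ (by positivity) (by positivity), Real.exp_add,
    Real.exp_add]
  set W := (n.descFactorial q : ℝ) * (lam / n) ^ q
  have hW : 0 ≤ W := by positivity
  calc _ ≤ W * L ^ (3 * k + 2 * b + a - q) * lam ^ b * y ^ a * (6 ^ (q / 3) * (q / 3).factorial) := by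
        gcongr
    _ = W * (L ^ (3 * k + 2 * b + a - q) * (6 ^ (q / 3) * (q / 3).factorial)) * lam ^ b * y ^ a := by
        ring
    _ ≤ W * (6 ^ k * k.factorial * Real.exp (L ^ 3) * ((N * L) ^ (2 * b + a))) * lam ^ b * y ^ a := by
        gcongr
    _ = W * (6 ^ k * k.factorial * Real.exp (L ^ 3)) * (((N * L) ^ 2 * lam) ^ b * (N * L * y) ^ a) := by
        rw [pow_add, pow_mul, mul_pow _ lam, mul_pow _ y]
        ring
    _ ≤ W * (6 ^ k * k.factorial * Real.exp (L ^ 3)) *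
          ((b.factorial * Real.exp ((N * L) ^ 2 * lam)) *
            (a.factorial * Real.exp (N * L * y))) := by
        gcongr
    _ = _ := by ring

lemma mainTerm_nonneg {lam : ℝ} (hlam : 0 < lam) (n q : ℕ) : 0 ≤ mainTerm lam n q := by
  unfold mainTerm
  positivity

lemma mainTerm_pos {lam : ℝ} (hlam : 0 < lam) {n q : ℕ} (hn : 0 < n) (hq : q ≤ n) :
    0 < mainTerm lam n q := by
  have : 0 < n.descFactorial q := Nat.pos_of_ne_zero (by simpa [Nat.descFactorial_eq_zero_iff_lt])
  unfold mainTerm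
  positivity

lemma erdosRenyi_real_le {lam : ℝ} (hlam : 0 < lam) :
    ∃ C : ℝ, 0 < C ∧ ∀ n q : ℕ, lam ≤ n → q ≤ n →
      (erdosRenyi lam n).real {G | q ≤ verticesInTriangles G} ≤
        (n + 1 : ℝ) ^ 3 * (mainTerm lam n q * Real.exp (C * (n : ℝ) ^ (2 / 3 : ℝ))) := by
  set L := max lam 1
  have hL : 1 ≤ L := le_max_right _ _
  have hlL : lam ≤ L := le_max_left _ _
  set y := 6 * lam + lam ^ 2 with hy
  have hy0 : 0 < y := by positivity
  refine ⟨L ^ 3 + 6 * L ^ 2 * lam + 6 * L * y, by positivity, fun n q hn hq => ?_⟩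
  have hn0 : (0 : ℝ) < n := hlam.trans_le hn
  have hnpos : 0 < n := by exact_mod_cast hn0
  have hn1 : (1 : ℝ) ≤ n := by exact_mod_cast hnpos
  -- The smallest `N` with `6 n ≤ N ^ 3`.
  set N : ℝ := (6 * n : ℝ) ^ (1 / 3 : ℝ)
  have hN : 1 ≤ N := Real.one_le_rpow (by linarith) (by norm_num)
  have hN3 : N ^ 3 = 6 * n := by
    rw [← Real.rpow_natCast, ← Real.rpow_mul (by positivity)]
    norm_num
  have hN2 : N ^ 2 ≤ 6 * (n : ℝ) ^ (2 / 3 : ℝ) := by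
    rw [← Real.rpow_natCast, ← Real.rpow_mul (by positivity), Real.mul_rpow (by norm_num) hn0.le]
    have h6 : (6 : ℝ) ^ (1 / 3 * ((2 : ℕ) : ℝ) : ℝ) ≤ 6 ^ (1 : ℝ) :=
      Real.rpow_le_rpow_of_exponent_le (by norm_num) (by norm_num)
    rw [Real.rpow_one] at h6
    have : (1 / 3 * ((2 : ℕ) : ℝ) : ℝ) = 2 / 3 := by norm_num
    rw [this] at h6 ⊢
    gcongr
  have hn23 : 1 ≤ (n : ℝ) ^ (2 / 3 : ℝ) := Real.one_le_rpow hn1 (by norm_num)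
  have hexp : L ^ 3 + (N * L) ^ 2 * lam + N * L * y ≤
      (L ^ 3 + 6 * L ^ 2 * lam + 6 * L * y) * (n : ℝ) ^ (2 / 3 : ℝ) := by
    have a1 : L ^ 3 ≤ L ^ 3 * (n : ℝ) ^ (2 / 3 : ℝ) := le_mul_of_one_le_right (by positivity) hn23
    have a2 : (N * L) ^ 2 * lam ≤ 6 * (n : ℝ) ^ (2 / 3 : ℝ) * (L ^ 2 * lam) := by
      rw [mul_pow, mul_assoc]
      gcongr
    have a3 : N * L * y ≤ 6 * (n : ℝ) ^ (2 / 3 : ℝ) * (L * y) := by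
      rw [mul_assoc]
      have : N ≤ 6 * (n : ℝ) ^ (2 / 3 : ℝ) := by nlinarith
      gcongr
    linarith
  have hp := coe_edgeProb hlam hn
  have hlp : (Fintype.card (Fin n) : ℝ) * edgeProb lam n = lam := by
    rw [hp, Fintype.card_fin, mul_div_cancel₀ _ hn0.ne']
  refine (real_le_verticesInTriangles_le (V := Fin n) (edgeProb lam n) q).trans ?_
  rw [hlp, hp, Fintype.card_fin]
  set R := mainTerm lam n q * Real.exp ((L ^ 3 + 6 * L ^ 2 * lam + 6 * L * y) * (n : ℝ) ^ (2 / 3 : ℝ))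
  have hR : 0 ≤ R := mul_nonneg (mainTerm_nonneg hlam n q) (Real.exp_pos _).le
  calc _ ≤ ∑ k ∈ Finset.range (n + 1), ∑ b ∈ Finset.range (n + 1),
        ∑ a ∈ Finset.range (n + 1), R := by
        refine Finset.sum_le_sum fun k _ => Finset.sum_le_sum fun b _ =>
          Finset.sum_le_sum fun a _ => ?_
        split_ifs with h
        · refine (term_le_mainTerm hlam hlL hL hN hnpos hq hN3.ge h).trans ?_
          exact mul_le_mul_of_nonneg_left (Real.exp_le_exp.2 hexp) (mainTerm_nonneg hlam n q)
        · exact hR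
    _ = _ := by
        simp only [Finset.sum_const, Finset.card_range, nsmul_eq_mul]
        push_cast
        ring

lemma le_erdosRenyi_real {lam : ℝ} (hlam : 0 < lam) :
    ∃ (C : ℝ) (D : ℕ), 0 < C ∧ ∀ n q : ℕ, lam ≤ n → 3 ≤ n → q ≤ n →
      mainTerm lam n q ≤
        C * (n : ℝ) ^ D * (erdosRenyi lam n).real {G | q ≤ verticesInTriangles G} := by
  set L := max lam 1
  have hL : 1 ≤ L := le_max_right _ _
  have hlL : lam ≤ L := le_max_left _ _
  obtain ⟨M, hM⟩ := exists_nat_ge (2 * (lam ^ 3 + 6 * lam ^ 2))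
  -- The two summands serve `q ≥ 3` and `q < 3`. The power `n ^ M` comes from `(k + M) ^ M`, and `n
  -- ^ 10` from at most two added vertices at a cost of order `n ^ 5` each.
  refine ⟨(M + 1 : ℝ) ^ M * (8 * L ^ 2 / lam ^ 4 + 12 * L ^ 2 / lam ^ 3), M + 10, by positivity,
    fun n q hn hn3 hq => ?_⟩
  have hn0 : (0 : ℝ) < n := hlam.trans_le hn
  have hnpos : 0 < n := by exact_mod_cast hn0
  have hn1 : (1 : ℝ) ≤ n := by exact_mod_cast hnpos
  have hp := coe_edgeProb hlam hn
  have hlp : (Fintype.card (Fin n) : ℝ) * edgeProb lam n = lam := by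
    rw [hp, Fintype.card_fin, mul_div_cancel₀ _ hn0.ne']
  have hp1 : lam / n ≤ 1 := (div_le_one hn0).2 hn
  set P : ℕ → ℝ := fun m => (erdosRenyi lam n).real {G | m ≤ verticesInTriangles G}
  have hP0 : ∀ m, 0 ≤ P m := fun m => measureReal_nonneg
  have hlow : ∀ k, n.descFactorial (3 * k) * (lam / n) ^ (3 * k) ≤
      2 * (6 ^ k * (k.factorial * (k + M : ℝ) ^ M)) * P (3 * k) := by
    intro k
    have := descFactorial_mul_pow_le (V := Fin n) (edgeProb lam n) (M := M)
      (by rw [hlp]; linarith) k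
    rwa [hp, Fintype.card_fin] at this
  have hKM : ∀ k : ℕ, k ≤ n → (k + M : ℝ) ^ M ≤ (M + 1 : ℝ) ^ M * (n : ℝ) ^ M := by
    intro k hk
    have hk' : (k : ℝ) ≤ n := by exact_mod_cast hk
    have hM0 : (0 : ℝ) ≤ M := by positivity
    rw [← mul_pow]
    exact pow_le_pow_left₀ (by positivity) (by nlinarith) _
  have hdiv : ∀ j : ℕ, j ≤ 2 → lam ^ j ≤ L ^ 2 := fun j hj =>
    (pow_le_pow_left₀ hlam.le hlL j).trans (pow_le_pow_right₀ hL hj)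
  -- For `q < 3` there may be no triangle to attach a vertex to. There the main term is bounded, and
  -- one triangle has at least polynomially small probability.
  rcases lt_or_ge q 3 with hq3 | hq3
  · have hE : mainTerm lam n q ≤ L ^ 2 := by
      have h0 : q / 3 = 0 := by omega
      have := descFactorial_mul_pow_add_le hlam le_rfl hnpos 0 q
      simp only [zero_add, Nat.descFactorial_zero, pow_zero, Nat.cast_one, one_mul] at this
      rw [mainTerm, h0]
      simpa using this.trans (hdiv q (by omega))
    have hPq : P 3 ≤ P q := measureReal_mono (fun G hG => le_trans hq3.le hG) (measure_ne_top _ _)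
    have h1 := hlow 1
    have hd : (1 : ℝ) ≤ n.descFactorial 3 := by
      exact_mod_cast Nat.pos_of_ne_zero fun h => by
        rw [Nat.descFactorial_eq_zero_iff_lt] at h
        omega
    have hk1 := hKM 1 (by omega)
    have h2 : (lam / n) ^ 3 ≤ 12 * ((M + 1 : ℝ) ^ M * (n : ℝ) ^ M) * P q := by
      calc (lam / n) ^ 3 ≤ n.descFactorial (3 * 1) * (lam / n) ^ (3 * 1) :=
            le_mul_of_one_le_left (by positivity) hd
        _ ≤ 2 * (6 ^ 1 * ((Nat.factorial 1 : ℕ) * ((1 : ℕ) + M : ℝ) ^ M)) * P (3 * 1) := h1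
        _ ≤ 2 * (6 ^ 1 * ((Nat.factorial 1 : ℕ) * ((M + 1 : ℝ) ^ M * (n : ℝ) ^ M))) * P q := by
            have := hP0 (3 * 1)
            gcongr
        _ = _ := by rw [Nat.factorial_one, Nat.cast_one]; ring
    have h3 : (1 : ℝ) ≤ (n : ℝ) ^ 3 / lam ^ 3 * (12 * ((M + 1 : ℝ) ^ M * (n : ℝ) ^ M) * P q) := by
      calc (1 : ℝ) = (n : ℝ) ^ 3 / lam ^ 3 * (lam / n) ^ 3 := by
            field_simp
        _ ≤ _ := by gcongr
    calc mainTerm lam n q ≤ L ^ 2 * 1 := by linarith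
      _ ≤ L ^ 2 * ((n : ℝ) ^ 3 / lam ^ 3 * (12 * ((M + 1 : ℝ) ^ M * (n : ℝ) ^ M) * P q)) := by
          gcongr
      _ = (M + 1 : ℝ) ^ M * (12 * L ^ 2 / lam ^ 3) * (n : ℝ) ^ (M + 3) * P q := by ring
      _ ≤ _ := by
          have := hP0 q
          gcongr
          · exact le_add_of_nonneg_left (by positivity)
          · norm_num
  · set K := q / 3 with hK
    obtain ⟨r, hr⟩ : ∃ r, q = 3 * K + r := ⟨q % 3, by omega⟩
    have hr2 : r ≤ 2 := by omega
    set R : ℝ := (1 + (n : ℝ) ^ 3) / (lam / n) ^ 2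
    have hpn : (lam / n) ^ 2 ≤ 1 := pow_le_one₀ (by positivity) hp1
    have hR1 : 1 ≤ R := by
      rw [one_le_div₀ (by positivity)]
      have : (0 : ℝ) ≤ (n : ℝ) ^ 3 := by positivity
      linarith
    have hstep : ∀ m, 1 ≤ m → m < n → P m ≤ R * P (m + 1) := by
      intro m hm hmn
      have := sq_mul_real_le (V := Fin n) (edgeProb lam n) hm (by simpa using hmn)
      rw [hp, Fintype.card_fin] at this
      rw [div_mul_eq_mul_div, le_div_iff₀' (by positivity)]
      exact this
    have hchain : ∀ s, 3 * K + s ≤ n → P (3 * K) ≤ R ^ s * P (3 * K + s) := by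
      intro s
      induction s with
      | zero => intro _; simp
      | succ s ih =>
        intro hs
        refine (ih (by omega)).trans ?_
        rw [pow_succ, mul_assoc]
        exact mul_le_mul_of_nonneg_left (hstep _ (by omega) (by omega)) (by positivity)
    have hPq : P (3 * K) ≤ R ^ 2 * P q := by
      refine (hchain r (by omega)).trans ?_
      rw [← hr]
      exact mul_le_mul_of_nonneg_right (pow_le_pow_right₀ hR1 hr2) (hP0 q)
    have hRn : R ≤ 2 * (n : ℝ) ^ 5 / lam ^ 2 := by
      have : (1 : ℝ) ≤ (n : ℝ) ^ 3 := one_le_pow₀ hn1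
      calc R = (1 + (n : ℝ) ^ 3) * (n : ℝ) ^ 2 / lam ^ 2 := by
            simp only [R]
            field_simp
        _ ≤ (2 * (n : ℝ) ^ 3) * (n : ℝ) ^ 2 / lam ^ 2 := by gcongr; linarith
        _ = _ := by ring
    have h1 : (n.descFactorial q : ℝ) * (lam / n) ^ q ≤
        n.descFactorial (3 * K) * (lam / n) ^ (3 * K) * L ^ 2 := by
      rw [hr]
      refine (descFactorial_mul_pow_add_le hlam le_rfl hnpos (3 * K) r).trans ?_
      exact mul_le_mul_of_nonneg_left (hdiv r hr2) (by positivity)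
    have hPK := hP0 (3 * K)
    have hPq0 := hP0 q
    have hk := hKM K (by omega)
    rw [mainTerm, ← hK, div_le_iff₀ (by positivity)]
    calc (n.descFactorial q : ℝ) * (lam / n) ^ q
        ≤ n.descFactorial (3 * K) * (lam / n) ^ (3 * K) * L ^ 2 := h1
      _ ≤ 2 * (6 ^ K * (K.factorial * (K + M : ℝ) ^ M)) * P (3 * K) * L ^ 2 := by
          exact mul_le_mul_of_nonneg_right (hlow K) (by positivity)
      _ ≤ 2 * (6 ^ K * (K.factorial * ((M + 1 : ℝ) ^ M * (n : ℝ) ^ M))) *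
            ((2 * (n : ℝ) ^ 5 / lam ^ 2) ^ 2 * P q) * L ^ 2 := by
          gcongr
          exact hPq.trans (by gcongr)
      _ = (M + 1 : ℝ) ^ M * (8 * L ^ 2 / lam ^ 4) * (n : ℝ) ^ (M + 10) * P q *
            (6 ^ K * K.factorial) := by ring
      _ ≤ _ := by
          gcongr
          exact le_add_of_nonneg_right (by positivity)

/-! ### Logarithmic estimates, the real factorial and Stirling's formula. -/

lemma log_natCast_le {n : ℕ} : Real.log n ≤ 3 / 2 * (n : ℝ) ^ (2 / 3 : ℝ) := by
  have := Real.log_le_rpow_div (Nat.cast_nonneg n) (show (0 : ℝ) < 2 / 3 by norm_num)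
  linarith

lemma one_le_rpow_two_thirds {n : ℕ} (hn : 1 ≤ n) : 1 ≤ (n : ℝ) ^ (2 / 3 : ℝ) :=
  Real.one_le_rpow (by exact_mod_cast hn) (by norm_num)

lemma log_add_le {n : ℕ} (hn : 1 ≤ n) {c : ℕ} :
    Real.log (n + c) ≤ (c + 3 / 2) * (n : ℝ) ^ (2 / 3 : ℝ) := by
  have hn1 : (1 : ℝ) ≤ n := by exact_mod_cast hn
  have hc : (0 : ℝ) ≤ c := by positivity
  have h1 : Real.log (n + c) ≤ Real.log ((1 + c) * n) :=
    Real.log_le_log (by positivity) (by nlinarith)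
  rw [Real.log_mul (by positivity) (by positivity)] at h1
  have h2 := Real.log_le_sub_one_of_pos (show (0 : ℝ) < 1 + c by positivity)
  have h3 := log_natCast_le (n := n)
  have h4 := one_le_rpow_two_thirds hn
  nlinarith

lemma abs_log_real_sub_log_mainTerm_le {lam : ℝ} (hlam : 0 < lam) :
    ∃ C : ℝ, ∀ n q : ℕ, lam ≤ n → 3 ≤ n → q ≤ n →
      0 < (erdosRenyi lam n).real {G | q ≤ verticesInTriangles G} ∧
      |Real.log ((erdosRenyi lam n).real {G | q ≤ verticesInTriangles G}) -
        Real.log (mainTerm lam n q)| ≤ C * (n : ℝ) ^ (2 / 3 : ℝ) := by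
  obtain ⟨C₁, hC₁, h1⟩ := erdosRenyi_real_le hlam
  obtain ⟨C₂, D, hC₂, h2⟩ := le_erdosRenyi_real hlam
  refine ⟨3 * (1 + 3 / 2) + C₁ + |Real.log C₂| + D * (3 / 2), fun n q hn hn3 hq => ?_⟩
  have hn0 : 0 < n := by omega
  have hn0' : (0 : ℝ) < n := by exact_mod_cast hn0
  have hE := mainTerm_pos hlam hn0 hq
  replace h1 := h1 n q hn hq
  replace h2 := h2 n q hn hn3 hq
  set P := (erdosRenyi lam n).real {G | q ≤ verticesInTriangles G}
  have hP : 0 < P := by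
    by_contra hP
    have : C₂ * (n : ℝ) ^ D * P ≤ 0 :=
      mul_nonpos_of_nonneg_of_nonpos (by positivity) (not_lt.1 hP)
    linarith
  have hpow := one_le_rpow_two_thirds (n := n) hn0
  have hlog := log_natCast_le (n := n)
  have hlog1 := log_add_le (n := n) hn0 (c := 1)
  have hD : (D : ℝ) * Real.log n ≤ D * (3 / 2 * (n : ℝ) ^ (2 / 3 : ℝ)) := by gcongr
  have hC := le_abs_self (Real.log C₂)
  have hC0 := abs_nonneg (Real.log C₂)
  have hC' : |Real.log C₂| ≤ |Real.log C₂| * (n : ℝ) ^ (2 / 3 : ℝ) := le_mul_of_one_le_right hC0 hpow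
  have hC1' : 0 ≤ C₁ * (n : ℝ) ^ (2 / 3 : ℝ) := by positivity
  have hD' : 0 ≤ D * (3 / 2 * (n : ℝ) ^ (2 / 3 : ℝ)) := by positivity
  push_cast at hlog1
  have l1 := Real.log_le_log hP h1
  rw [Real.log_mul (by positivity) (by positivity), Real.log_mul (by positivity) (by positivity),
    Real.log_exp, Real.log_pow] at l1
  have l2 := Real.log_le_log hE h2
  rw [Real.log_mul (by positivity) (by positivity), Real.log_mul (by positivity) (by positivity),
    Real.log_pow] at l2
  push_cast at l1
  refine ⟨hP, abs_le.2 ⟨?_, ?_⟩⟩ <;> nlinarith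

/-- `q / 3` may be rounded down in the factorial at the cost of a polynomial factor. -/
lemma realFactorial_bounds (q : ℕ) :
    ((q / 3).factorial : ℝ) ≤ (q + 3) * realFactorial ((q : ℝ) / 3) ∧
      realFactorial ((q : ℝ) / 3) ≤ (q + 3) ^ 2 * (q / 3).factorial := by
  set K := q / 3 with hK
  set x : ℝ := (q : ℝ) / 3 with hx
  have h1 : (K : ℝ) ≤ x := by
    rw [hx, le_div_iff₀ (by norm_num)]
    exact_mod_cast (by omega : K * 3 ≤ q)
  have h2 : x ≤ K + 1 := by
    rw [hx, div_le_iff₀ (by norm_num)]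
    exact_mod_cast (by omega : q ≤ (K + 1) * 3)
  have hx0 : 0 ≤ x := by positivity
  have hK0 : (0 : ℝ) ≤ K := by positivity
  have hKq : (K : ℝ) ≤ q := by exact_mod_cast Nat.div_le_self q 3
  have hxq : x ≤ q := by
    have : (0 : ℝ) ≤ q := by positivity
    linarith
  -- The monotonicity of Gamma is available on `[2, ∞)`, hence the shift by one: `Γ(x + 2)` lies
  -- between `(K + 1)!` and `(K + 2)!`.
  have hrec : Real.Gamma (x + 2) = (x + 1) * realFactorial x := by
    rw [realFactorial, ← Real.Gamma_add_one (by positivity)]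
    ring_nf
  have hpos : 0 < realFactorial x := Real.Gamma_pos_of_pos (by positivity)
  have hmono := Real.Gamma_strictMonoOn_Ici.monotoneOn
  have hlow : ((K + 1).factorial : ℝ) ≤ Real.Gamma (x + 2) := by
    rw [← Real.Gamma_nat_eq_factorial]
    push_cast
    refine hmono ?_ ?_ (by linarith) <;> rw [Set.mem_Ici] <;> linarith
  have hup : Real.Gamma (x + 2) ≤ (K + 2).factorial := by
    rw [← Real.Gamma_nat_eq_factorial]
    push_cast
    refine hmono ?_ ?_ (by linarith) <;> rw [Set.mem_Ici] <;> linarith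
  have hfac : (0 : ℝ) < K.factorial := by positivity
  rw [hrec] at hlow hup
  rw [Nat.factorial_succ] at hlow
  rw [Nat.factorial_succ, Nat.factorial_succ] at hup
  push_cast at hlow hup
  constructor
  · calc (K.factorial : ℝ) ≤ (K + 1) * K.factorial := le_mul_of_one_le_left hfac.le (by linarith)
      _ ≤ (x + 1) * realFactorial x := hlow
      _ ≤ _ := by gcongr; linarith
  · calc realFactorial x ≤ (x + 1) * realFactorial x :=
          le_mul_of_one_le_left hpos.le (by linarith)
      _ ≤ (K + 1 + 1) * ((K + 1) * K.factorial) := hup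
      _ = ((K + 1 + 1) * (K + 1)) * K.factorial := by ring
      _ ≤ _ := by
          rw [sq]
          exact mul_le_mul_of_nonneg_right
            (mul_le_mul (by linarith) (by linarith) (by positivity) (by positivity)) hfac.le

/-- The right-hand side without the error factor. -/
noncomputable def gammaTerm (lam : ℝ) (n q : ℕ) : ℝ :=
  (n.descFactorial q : ℝ) /
    ((Nat.factorial 3 : ℝ) ^ ((q : ℝ) / 3) * realFactorial ((q : ℝ) / 3)) * (lam / n) ^ q

lemma gammaTerm_pos {lam : ℝ} (hlam : 0 < lam) {n q : ℕ} (hn : 0 < n) (hq : q ≤ n) :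
    0 < gammaTerm lam n q := by
  have h1 : 0 < n.descFactorial q :=
    Nat.pos_of_ne_zero (by simpa [Nat.descFactorial_eq_zero_iff_lt])
  have h2 : 0 < realFactorial ((q : ℝ) / 3) := Real.Gamma_pos_of_pos (by positivity)
  unfold gammaTerm
  positivity

lemma abs_log_mainTerm_sub_log_gammaTerm_le {lam : ℝ} (hlam : 0 < lam) :
    ∃ C : ℝ, ∀ n q : ℕ, 1 ≤ n → q ≤ n →
      |Real.log (mainTerm lam n q) - Real.log (gammaTerm lam n q)| ≤ C * (n : ℝ) ^ (2 / 3 : ℝ) := by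
  refine ⟨2 * (3 + 3 / 2) + Real.log 6, fun n q hn hq => ?_⟩
  have hn0 : (0 : ℝ) < n := by exact_mod_cast hn
  have h1 : 0 < n.descFactorial q :=
    Nat.pos_of_ne_zero (by simpa [Nat.descFactorial_eq_zero_iff_lt])
  have hpos : 0 < realFactorial ((q : ℝ) / 3) := Real.Gamma_pos_of_pos (by positivity)
  obtain ⟨g1, g2⟩ := realFactorial_bounds q
  have l1 := Real.log_le_log (by positivity) g1
  have l2 := Real.log_le_log (by positivity) g2
  rw [Real.log_mul (by positivity) (by positivity)] at l1 l2
  rw [Real.log_pow] at l2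
  have hlq : Real.log (q + 3) ≤ Real.log (n + 3) :=
    Real.log_le_log (by positivity) (by
      have : (q : ℝ) ≤ n := by exact_mod_cast hq
      linarith)
  have hlog := log_add_le (n := n) hn (c := 3)
  push_cast at hlog l2
  have hpow := one_le_rpow_two_thirds hn
  have h6 : 0 < Real.log 6 := Real.log_pos (by norm_num)
  have f3 : (Nat.factorial 3 : ℝ) = 6 := by norm_num [Nat.factorial]
  have e1 : Real.log (mainTerm lam n q) = Real.log (n.descFactorial q) + Real.log ((lam / n) ^ q) -
      ((q / 3 : ℕ) * Real.log 6 + Real.log (q / 3).factorial) := by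
    rw [mainTerm, Real.log_div (by positivity) (by positivity),
      Real.log_mul (by positivity) (by positivity), Real.log_mul (by positivity) (by positivity),
      Real.log_pow 6]
  have e2 : Real.log (gammaTerm lam n q) = Real.log (n.descFactorial q) + Real.log ((lam / n) ^ q) -
      ((q : ℝ) / 3 * Real.log 6 + Real.log (realFactorial ((q : ℝ) / 3))) := by
    rw [gammaTerm, f3, Real.log_mul (by positivity) (by positivity),
      Real.log_div (by positivity) (by positivity), Real.log_mul (by positivity) (by positivity),
      Real.log_rpow (by norm_num)]
    ring
  have k1 : ((q / 3 : ℕ) : ℝ) ≤ (q : ℝ) / 3 := by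
    rw [le_div_iff₀ (by norm_num)]
    exact_mod_cast (by omega : q / 3 * 3 ≤ q)
  have k2 : (q : ℝ) / 3 ≤ (q / 3 : ℕ) + 1 := by
    rw [div_le_iff₀ (by norm_num)]
    exact_mod_cast (by omega : q ≤ (q / 3 + 1) * 3)
  have k3 : ((q / 3 : ℕ) : ℝ) * Real.log 6 ≤ (q : ℝ) / 3 * Real.log 6 := by gcongr
  have k4 : (q : ℝ) / 3 * Real.log 6 ≤ ((q / 3 : ℕ) + 1) * Real.log 6 := by gcongr
  have k5 : Real.log 6 ≤ Real.log 6 * (n : ℝ) ^ (2 / 3 : ℝ) := le_mul_of_one_le_right h6.le hpow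
  rw [e1, e2]
  refine abs_le.2 ⟨?_, ?_⟩ <;> nlinarith

/-- Stirling's formula up to a logarithmic error. -/
lemma abs_log_factorial_sub_le (m : ℕ) :
    |Real.log m.factorial - (m * Real.log m - m)| ≤ Real.log (m + 1) + 1 := by
  rcases Nat.eq_zero_or_pos m with rfl | hm
  · simp
  have hm' : (0 : ℝ) < m := by exact_mod_cast hm
  have hf := Stirling.log_stirlingSeq_formula m
  -- The Stirling sequence decreases from `e / √2` and stays above `√π`, so its logarithm lies in
  -- `[0, 1]`.
  have hlow : 0 ≤ Real.log (Stirling.stirlingSeq m) := by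
    refine Real.log_nonneg (le_trans ?_ (Stirling.sqrt_pi_le_stirlingSeq hm.ne'))
    exact Real.one_le_sqrt.2 (by linarith [Real.pi_gt_three])
  have hup : Real.log (Stirling.stirlingSeq m) ≤ 1 := by
    obtain ⟨k, rfl⟩ := Nat.exists_eq_succ_of_ne_zero hm.ne'
    have h1 : Stirling.stirlingSeq (k + 1) ≤ Stirling.stirlingSeq 1 :=
      Stirling.stirlingSeq'_antitone (Nat.zero_le k)
    rw [Stirling.stirlingSeq_one] at h1
    have h2 : Real.exp 1 / √2 ≤ Real.exp 1 := by
      refine div_le_self (Real.exp_pos _).le ?_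
      exact Real.one_le_sqrt.2 (by norm_num)
    have := Real.log_le_log (Stirling.stirlingSeq'_pos k) (h1.trans h2)
    rwa [Real.log_exp] at this
  rw [Real.log_div hm'.ne' (Real.exp_ne_zero _), Real.log_exp] at hf
  have h2m : Real.log (2 * m) ≤ 2 * Real.log (m + 1) := by
    have := Real.log_le_log (by positivity) (by nlinarith : (2 * m : ℝ) ≤ (m + 1) ^ 2)
    rw [Real.log_pow] at this
    exact_mod_cast this
  have h2m0 : 0 ≤ Real.log (2 * m) := by
    refine Real.log_nonneg ?_
    have : (1 : ℝ) ≤ m := by exact_mod_cast hm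
    linarith
  rw [abs_le]
  constructor <;> linarith

/-- The derivative of `x log x` is `log x + 1`. This controls the effect of rounding in Stirling's
formula. -/
lemma abs_mul_log_sub_le {x y N : ℝ} (hx : 1 ≤ x) (hy : 1 ≤ y) (hxN : x ≤ N) (hyN : y ≤ N)
    (hxy : |x - y| ≤ 1) : |x * Real.log x - y * Real.log y| ≤ Real.log N + 1 := by
  wlog h : x ≤ y generalizing x y
  · rw [abs_sub_comm]
    exact this hy hx hyN hxN (by rwa [abs_sub_comm]) (not_le.1 h).le
  have hlx : 0 ≤ Real.log x := Real.log_nonneg hx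
  have hly : 0 ≤ Real.log y := Real.log_nonneg hy
  have hl : Real.log x ≤ Real.log y := Real.log_le_log (by linarith) h
  have hlN : Real.log y ≤ Real.log N := Real.log_le_log (by linarith) hyN
  have h1 : x * (Real.log y - Real.log x) ≤ y - x := by
    rw [← Real.log_div (by linarith) (by linarith)]
    have := Real.log_le_sub_one_of_pos (show 0 < y / x by positivity)
    calc x * Real.log (y / x) ≤ x * (y / x - 1) := by gcongr
      _ = y - x := by field_simp
  have h2 : y - x ≤ 1 := by
    rw [abs_sub_comm] at hxy
    exact (le_abs_self _).trans hxy
  rw [abs_sub_comm, abs_of_nonneg]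
  · nlinarith
  · nlinarith

/-- Stirling's formula applies to `n!`, `(n - q)!` and `K!`, with `q = ⌈a n⌉` and `K = q / 3`
rounded down. The terms `n log n` cancel up to rounding, and the linear terms `-n + (n - q) + K`
leave `-(2/3) a n`. -/
lemma abs_log_mainTerm_ceil_le {lam a : ℝ} (hlam : 0 < lam) (ha : 0 < a) (ha1 : a < 1) :
    ∃ C : ℝ, ∀ᶠ n : ℕ in atTop,
      |Real.log (mainTerm lam n ⌈a * n⌉₊) -
        (-(n * (1 - a) * Real.log (1 - a)) - (a * n / 3) * Real.log (a * n / 3)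
            - a * n * (2 / 3 + 1 / 3 * Real.log 6) + a * n * Real.log lam)| ≤
        C * (n : ℝ) ^ (2 / 3 : ℝ) := by
  -- In order: three Stirling errors, two rounding errors in `x log x`, and rounding in `q log n`,
  -- in the linear terms, in `K log 6` and in `q log lam`.
  refine ⟨3 * (1 + 3 / 2 + 1) + 2 * (3 / 2 + 1) + 3 / 2 + 2 + Real.log 6 + |Real.log lam|, ?_⟩
  -- These thresholds make `a n / 3`, `K`, `(1 - a) n` and `n - q` at least 1, as
  -- `abs_mul_log_sub_le` requires.
  have t1 : ∀ᶠ n : ℕ in atTop, 6 / a ≤ n := tendsto_natCast_atTop_atTop.eventually_ge_atTop _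
  have t2 : ∀ᶠ n : ℕ in atTop, 2 / (1 - a) ≤ n := tendsto_natCast_atTop_atTop.eventually_ge_atTop _
  filter_upwards [t1, t2, eventually_ge_atTop 1] with n h1 h2 hn
  have hn1 : (1 : ℝ) ≤ n := by exact_mod_cast hn
  have hn0 : (0 : ℝ) < n := by linarith
  have ha' : 0 < 1 - a := by linarith
  rw [div_le_iff₀' ha] at h1
  rw [div_le_iff₀' ha'] at h2
  have han : 0 < a * n := by positivity
  set q := ⌈a * n⌉₊ with hq
  have q1 : a * n ≤ q := Nat.le_ceil _
  have q2 : (q : ℝ) < a * n + 1 := Nat.ceil_lt_add_one han.le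
  have hqn : q ≤ n := Nat.ceil_le.2 (by nlinarith)
  have hqn' : ((n - q : ℕ) : ℝ) = n - q := by rw [Nat.cast_sub hqn]
  set K := q / 3 with hK
  have k1 : (K : ℝ) * 3 ≤ q := by exact_mod_cast (by omega : K * 3 ≤ q)
  have k2 : (q : ℝ) ≤ K * 3 + 2 := by exact_mod_cast (by omega : q ≤ K * 3 + 2)
  have s0 := abs_le.1 (abs_log_factorial_sub_le n)
  have s1 := abs_le.1 (abs_log_factorial_sub_le (n - q))
  have s2 := abs_le.1 (abs_log_factorial_sub_le K)
  have m1 : Real.log ((n - q : ℕ) + 1) ≤ Real.log (n + 1) :=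
    Real.log_le_log (by positivity) (by rw [hqn']; linarith)
  have m2 : Real.log (K + 1) ≤ Real.log (n + 1) :=
    Real.log_le_log (by positivity) (by
      have : (q : ℝ) ≤ n := by exact_mod_cast hqn
      have : (0 : ℝ) ≤ K := by positivity
      linarith)
  have d1 := abs_le.1 (abs_mul_log_sub_le (x := (1 - a) * n) (y := (n : ℝ) - q) (N := n) (by linarith)
    (by linarith) (by nlinarith) (by linarith) (abs_le.2 ⟨by linarith, by linarith⟩))
  have d2 := abs_le.1 (abs_mul_log_sub_le (x := a * n / 3) (y := K) (N := n) (by linarith)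
    (by linarith) (by nlinarith)
    (by have : (q : ℝ) ≤ n := by exact_mod_cast hqn
        linarith) (abs_le.2 ⟨by linarith, by linarith⟩))
  have hdf : Real.log (n.descFactorial q) = Real.log n.factorial - Real.log (n - q).factorial := by
    have hpos : 0 < n.descFactorial q :=
      Nat.pos_of_ne_zero (by simpa [Nat.descFactorial_eq_zero_iff_lt])
    have := Nat.factorial_mul_descFactorial hqn
    rw [← this]
    push_cast
    rw [Real.log_mul (by positivity) (by positivity)]
    ring
  have e1 : Real.log (mainTerm lam n q) = Real.log n.factorial - Real.log (n - q).factorial +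
      q * (Real.log lam - Real.log n) - (K * Real.log 6 + Real.log K.factorial) := by
    have hpos : 0 < n.descFactorial q :=
      Nat.pos_of_ne_zero (by simpa [Nat.descFactorial_eq_zero_iff_lt])
    rw [mainTerm, Real.log_div (by positivity) (by positivity),
      Real.log_mul (by positivity) (by positivity), Real.log_mul (by positivity) (by positivity),
      Real.log_pow, Real.log_pow, Real.log_div (by positivity) (by positivity), hdf]
  have e2 : Real.log ((1 - a) * n) = Real.log (1 - a) + Real.log n :=
    Real.log_mul (by positivity) (by positivity)
  have hlogn : 0 ≤ Real.log n := Real.log_nonneg hn1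
  have hl1 := log_natCast_le (n := n)
  have hl2 := log_add_le (n := n) hn (c := 1)
  have hpow := one_le_rpow_two_thirds hn
  have h6 : 0 < Real.log 6 := Real.log_pos (by norm_num)
  have b6 := le_mul_of_one_le_right h6.le hpow
  have bl := le_mul_of_one_le_right (abs_nonneg (Real.log lam)) hpow
  have c1 : |(q - a * n) * Real.log lam| ≤ |Real.log lam| := by
    rw [abs_mul]
    exact mul_le_of_le_one_left (abs_nonneg _) (abs_le.2 ⟨by linarith, by linarith⟩)
  have c2 : |(a * n / 3 - K) * Real.log 6| ≤ Real.log 6 := by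
    rw [abs_mul, abs_of_pos h6]
    exact mul_le_of_le_one_left h6.le (abs_le.2 ⟨by linarith, by linarith⟩)
  have c3 : |(a * n - q) * Real.log n| ≤ Real.log n := by
    rw [abs_mul, abs_of_nonneg hlogn]
    exact mul_le_of_le_one_left hlogn (abs_le.2 ⟨by linarith, by linarith⟩)
  rw [abs_le] at c1 c2 c3
  rw [e2] at d1
  rw [hqn'] at s1 m1
  push_cast at hl2
  rw [e1]
  refine abs_le.2 ⟨?_, ?_⟩ <;> linarith

lemma isLittleO_rpow_two_thirds :
    (fun n : ℕ => (n : ℝ) ^ (2 / 3 : ℝ)) =o[atTop] fun n : ℕ => (n : ℝ) ^ (19 / 20 : ℝ) := by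
  refine Asymptotics.isLittleO_of_tendsto' ?_ ?_
  · filter_upwards [eventually_ge_atTop 1] with n hn h0
    have : (0 : ℝ) < n := by exact_mod_cast hn
    exact absurd h0 (by positivity)
  -- Here `17/60 = 19/20 - 2/3`.
  · refine ((tendsto_rpow_neg_atTop (show (0 : ℝ) < 17 / 60 by norm_num)).comp
      tendsto_natCast_atTop_atTop).congr' ?_
    filter_upwards [eventually_ge_atTop 1] with n hn
    have : (0 : ℝ) < n := by exact_mod_cast hn
    rw [Function.comp_apply, ← Real.rpow_sub this]
    norm_num

lemma verticesInTriangles_le {n : ℕ} (G : SimpleGraph (Fin n)) : verticesInTriangles G ≤ n := by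
  refine (Set.ncard_le_ncard (Set.subset_univ _) Set.finite_univ).trans ?_
  simp [Set.ncard_univ]

end RandomGraph


theorem theorem2p1 (lam : ℝ) (hlam : 0 < lam) :
    (∃ r : ℕ → ℕ → ℝ,
      (∀ ε : ℝ, 0 < ε →
        ∀ᶠ n : ℕ in Filter.atTop, ∀ q : ℕ, |r n q| ≤ ε * (n : ℝ) ^ (19 / 20 : ℝ)) ∧
      ∀ᶠ n : ℕ in Filter.atTop, ∀ q : ℕ,
        (erdosRenyi lam n).real {G | q ≤ verticesInTriangles G} =
          (n.descFactorial q : ℝ) /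
              ((Nat.factorial 3 : ℝ) ^ ((q : ℝ) / 3) * realFactorial ((q : ℝ) / 3)) *
            (lam / n) ^ q * Real.exp (r n q)) ∧
    ∀ a : ℝ, 0 < a → a < 1 →
      (fun n : ℕ =>
        Real.log ((erdosRenyi lam n).real {G | a * n ≤ (verticesInTriangles G : ℝ)}) -
          (-(n * (1 - a) * Real.log (1 - a)) - (a * n / 3) * Real.log (a * n / 3)
            - a * n * (2 / 3 + 1 / 3 * Real.log 6) + a * n * Real.log lam))
        =o[Filter.atTop] fun n : ℕ => (n : ℝ) ^ (19 / 20 : ℝ) := by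
  obtain ⟨C₁, h1⟩ := RandomGraph.abs_log_real_sub_log_mainTerm_le hlam
  obtain ⟨C₂, h2⟩ := RandomGraph.abs_log_mainTerm_sub_log_gammaTerm_le hlam
  have hge : ∀ᶠ n : ℕ in Filter.atTop, lam ≤ n :=
    tendsto_natCast_atTop_atTop.eventually_ge_atTop _
  -- The error is the logarithm of the ratio of the two sides. For `q > n` both sides vanish, so any
  -- value serves and 0 keeps the bound uniform.
  refine ⟨⟨fun n q => if q ≤ n then
    Real.log ((erdosRenyi lam n).real {G | q ≤ verticesInTriangles G}) -
      Real.log (RandomGraph.gammaTerm lam n q) else 0, ?_, ?_⟩, ?_⟩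
  · intro ε hε
    have ho := (RandomGraph.isLittleO_rpow_two_thirds.const_mul_left (|C₁| + |C₂|)).bound hε
    filter_upwards [ho, hge, Filter.eventually_ge_atTop 3] with n hn hlamn hn3 q
    rw [Real.norm_of_nonneg (by positivity), Real.norm_of_nonneg (by positivity)] at hn
    split_ifs with hq
    · have a1 := (h1 n q hlamn hn3 hq).2
      have a2 := h2 n q (by omega) hq
      have hpos : (0 : ℝ) ≤ (n : ℝ) ^ (2 / 3 : ℝ) := by positivity
      have b1 := mul_le_mul_of_nonneg_right (le_abs_self C₁) hpos
      have b2 := mul_le_mul_of_nonneg_right (le_abs_self C₂) hpos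
      have := abs_sub_le (Real.log ((erdosRenyi lam n).real {G | q ≤ verticesInTriangles G}))
        (Real.log (RandomGraph.mainTerm lam n q)) (Real.log (RandomGraph.gammaTerm lam n q))
      linarith
    · rw [abs_zero]
      positivity
  · filter_upwards [hge, Filter.eventually_ge_atTop 3] with n hlamn hn3 q
    by_cases hq : q ≤ n
    · have hP := (h1 n q hlamn hn3 hq).1
      have hF := RandomGraph.gammaTerm_pos hlam (by omega : 0 < n) hq
      change _ = RandomGraph.gammaTerm lam n q * _
      rw [if_pos hq, Real.exp_sub, Real.exp_log hP, Real.exp_log hF, mul_div_cancel₀ _ hF.ne']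
    · have hempty : {G : SimpleGraph (Fin n) | q ≤ verticesInTriangles G} = ∅ := by
        ext G
        simp only [Set.mem_ofPred_eq, Set.mem_empty_iff_false, iff_false]
        exact fun h => hq (h.trans (RandomGraph.verticesInTriangles_le G))
      rw [hempty, Nat.descFactorial_of_lt (not_le.1 hq)]
      simp
  · intro a ha ha1
    obtain ⟨C₃, h3⟩ := RandomGraph.abs_log_mainTerm_ceil_le hlam ha ha1
    refine Asymptotics.IsBigO.trans_isLittleO ?_ RandomGraph.isLittleO_rpow_two_thirds
    refine Asymptotics.IsBigO.of_bound (C₁ + C₃) ?_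
    filter_upwards [h3, hge, Filter.eventually_ge_atTop 3] with n h3 hlamn hn3
    have hset : {G : SimpleGraph (Fin n) | a * n ≤ (verticesInTriangles G : ℝ)} =
        {G | ⌈a * n⌉₊ ≤ verticesInTriangles G} := by
      ext G
      simp only [Set.mem_ofPred_eq, Nat.ceil_le]
    have hq : ⌈a * n⌉₊ ≤ n := Nat.ceil_le.2 (mul_le_of_le_one_left (Nat.cast_nonneg n) ha1.le)
    have a1 := (h1 n _ hlamn hn3 hq).2
    rw [hset, Real.norm_eq_abs, Real.norm_of_nonneg (by positivity)]
    refine (abs_sub_le _ (Real.log (RandomGraph.mainTerm lam n ⌈a * n⌉₊)) _).trans ?_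
    linarith
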